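/- Let $d\in\{1,2,3\}$, let $\Omega\subset\mathbb R^d$ be a bounded domain (open, connected, nonempty), $0<\alpha<1$, $T>0$, $x_0\in\Omega$, and $g:\Omega\to\mathbb R$. Write $$\partial_t^\alpha f(t)=\frac1{\Gamma(1-\alpha)}\int_0^t\frac{f'(s)}{(t-s)^{\alpha}}\,ds$$ for the Caputo derivative; we use it for $f$ that are continuous on $[0,T]$ and differentiable in $(0,T)$ with $f'\in L^1(0,T)$. A solution of $$(\partial_t^\alpha-\Delta)u=F\ \text{ in }\Omega\times(0,T),\qquad u(\cdot,0)=u_0\ \text{ in }\Omega,\qquad u=0\ \text{ on }\partial\Omega\times(0,T)$$ means a function $u$ that is continuous on $\Omega\times[0,T]$, satisfies $u(\cdot,0)=u_0$ in $\Omega$, belongs to $L^1(0,T;H_0^1(\Omega))$, and is such that for every $\varphi\in C_c^\infty(\Omega)$ the function $t\mapsto\int_\Omega u(x,t)\varphi(x)\,dx$ is in the above class and $$\partial_t^\alpha\!\int_\Omega u\,\varphi\,dx+\int_\Omega\nabla u\cdot\nabla\varphi\,dx=\int_\Omega F\varphi\,dx\quad\text{for a.e. }t\in(0,T).$$ For $\rho:[0,T]\to\mathbb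 R$ let $u_\rho$ be the solution with $F(x,t)=\rho(t)g(x)$ and $u_0=0$. Assume that $v$ is a solution with $F=0$, $u_0=g$, and that $0\le v(x_0,t)\le K$ for $0\le t\le T$, with a constant $K>0$. Let $L\ge1$ be an integer, and let $\rho_*\in C^\infty[0,T]$ satisfy $\rho_*^{(m)}(0)=0$ for all $m\ge0$. Put $u_*=u_{\rho_*}(x_0,\cdot)$ and consider the iteration $$\rho_0=0,\qquad \rho_m=\rho_{m-1}+\frac1K\,\partial_t^\alpha\bigl(u_*-u_{\rho_{m-1}}(x_0,\cdot)\bigr)\quad\text{on }[0,T],\qquad m=1,2,\dots$$ Then the iteration can be carried out (the solutions $u_{\rho_*},u_{\rho_m}$ exist, and each $u_*-u_{\rho_m}(x_0,\cdot)$ is in the class on which $\partial_t^\alpha$ is defined), and every sequence $(\rho_m)_{m\ge0}$ generated by it consists of continuous functions on $[0,T]$ and has the following properties. 1. For every $m\ge0$ and $M\in\mathbb R$: if $\|\rho_*^{(m)}\|_{C[0,T]}\le M(8L/T)^m$, then $$\|\rho_m-\rho_*\|_{C[0,T]}\le\frac{M(8L)^m}{m!}.$$ 2. If, with one constant $M$,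 $\|\rho_*^{(m)}\|_{C[0,T]}\le M(8L/T)^m$ for all $m=0,1,2,\dots$, then $\rho_m\to\rho_*$ uniformly on $[0,T]$ (and the bound in 1 holds for every $m$). -/

import Mathlib

open MeasureTheory Set Filter Topology
open scoped ContDiff

noncomputable section

/-- The Caputo derivative of order `α`, for `0 < α < 1`:
`(1 / Γ(1 - α)) ∫₀ᵗ f'(s) / (t - s)^α ds`. -/
def caputo (α : ℝ) (f : ℝ → ℝ) (t : ℝ) : ℝ :=
  (1 / Real.Gamma (1 - α)) * ∫ s in (0 : ℝ)..t, deriv f s / (t - s) ^ α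

/-- The functions on `[0, T]` whose Caputo derivative makes classical sense: continuous on
`[0, T]`, differentiable in `(0, T)`, with integrable derivative. -/
def CaputoAdmissible (T : ℝ) (f : ℝ → ℝ) : Prop :=
  ContinuousOn f (Icc 0 T) ∧ DifferentiableOn ℝ f (Ioo 0 T) ∧ IntegrableOn (deriv f) (Ioo 0 T)

/-- `φ ∈ C_c^∞(Ω)`. -/
def IsTestFunction {d : ℕ} (Ω : Set (EuclideanSpace ℝ (Fin d)))
    (φ : EuclideanSpace ℝ (Fin d) → ℝ) : Prop :=
  ContDiff ℝ ∞ φ ∧ HasCompactSupport φ ∧ tsupport φ ⊆ Ω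

/-- `H₀¹(Ω)`: the closure of `C_c^∞(Ω)` in the `H¹` topology. A function in `H₀¹(Ω)` is recorded
with its weak gradient, as a pair `(w, ∇w)` in `L²(Ω) × L²(Ω; ℝᵈ)`. -/
def H10 {d : ℕ} (Ω : Set (EuclideanSpace ℝ (Fin d))) :
    Set (Lp ℝ 2 (volume.restrict Ω) × Lp (EuclideanSpace ℝ (Fin d)) 2 (volume.restrict Ω)) :=
  closure {p | ∃ φ : EuclideanSpace ℝ (Fin d) → ℝ, IsTestFunction Ω φ ∧
    p.1 =ᵐ[volume.restrict Ω] φ ∧ p.2 =ᵐ[volume.restrict Ω] gradient φ}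

/-- `u` is a (continuous, weak) solution of the initial-boundary value problem
`(∂_t^α - Δ) u = ρ(t) g(x)` in `Ω × (0, T)`, `u = u₀` at `t = 0`, `u = 0` on `∂Ω × (0, T)`.

The homogeneous Dirichlet condition is `u ∈ L¹(0, T; H₀¹(Ω))`; the equation is tested with
`φ ∈ C_c^∞(Ω)` in space and holds for almost every time, with the Caputo derivative of
`t ↦ ∫_Ω u(x, t) φ(x) dx`. Continuity on `Ω × [0, T]` gives a meaning to point values. -/
def IsSolution {d : ℕ} (α T : ℝ) (Ω : Set (EuclideanSpace ℝ (Fin d))) (ρ : ℝ → ℝ)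
    (g u₀ : EuclideanSpace ℝ (Fin d) → ℝ) (u : EuclideanSpace ℝ (Fin d) → ℝ → ℝ) : Prop :=
  ContinuousOn (fun p : EuclideanSpace ℝ (Fin d) × ℝ => u p.1 p.2) (Ω ×ˢ Icc 0 T) ∧
  (∀ x ∈ Ω, u x 0 = u₀ x) ∧
  ∃ U : ℝ → Lp ℝ 2 (volume.restrict Ω) ×
      Lp (EuclideanSpace ℝ (Fin d)) 2 (volume.restrict Ω),
    IntegrableOn U (Ioo 0 T) ∧
    (∀ᵐ t ∂volume.restrict (Ioo 0 T),
      U t ∈ H10 Ω ∧ (U t).1 =ᵐ[volume.restrict Ω] fun x => u x t) ∧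
    ∀ φ : EuclideanSpace ℝ (Fin d) → ℝ, IsTestFunction Ω φ →
      CaputoAdmissible T (fun t => ∫ x in Ω, u x t * φ x) ∧
      ∀ᵐ t ∂volume.restrict (Ioo 0 T),
        caputo α (fun s => ∫ x in Ω, u x s * φ x) t +
            ∫ x in Ω, inner ℝ ((U t).2 x) (gradient φ x) =
          ρ t * ∫ x in Ω, g x * φ x

/-- The sequence `ρ` is generated on `[0, T]` by `ρ₀ = 0` and
`ρ_{m+1} = ρ_m + ∂_t^α (u_* - u_{ρ_m}(x₀, ·)) / K`, where `u_* = u_{ρ_*}(x₀, ·)` and, for a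
temporal source `r`, `u_r` is the solution with source `r(t) g(x)` and zero initial value. -/
def IsIteration {d : ℕ} (α T K : ℝ) (Ω : Set (EuclideanSpace ℝ (Fin d)))
    (g : EuclideanSpace ℝ (Fin d) → ℝ) (x₀ : EuclideanSpace ℝ (Fin d)) (ρstar : ℝ → ℝ)
    (ρ : ℕ → ℝ → ℝ) : Prop :=
  ∃ (ustar : EuclideanSpace ℝ (Fin d) → ℝ → ℝ) (u : ℕ → EuclideanSpace ℝ (Fin d) → ℝ → ℝ),
    IsSolution α T Ω ρstar g 0 ustar ∧
    (∀ m, IsSolution α T Ω (ρ m) g 0 (u m)) ∧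
    (∀ t ∈ Icc 0 T, ρ 0 t = 0) ∧
    (∀ m, CaputoAdmissible T (fun s => ustar x₀ s - u m x₀ s)) ∧
    ∀ m, ∀ t ∈ Icc 0 T,
      ρ (m + 1) t = ρ m t + caputo α (fun s => ustar x₀ s - u m x₀ s) t / K

end

/-! Write `*` for convolution over `(0, t)`, `k_a` for `rlKernel a` and `V = v(x₀, ·)`. For a source
with `ρ(0) = ρ'(0) = 0`, Duhamel's principle gives `u_ρ = (k_α * ρ') * v` (`IsSolution.duhamel`).
Since `k_{1-α} * k_α = 1`, the Caputo derivative of `u_ρ(x₀, ·)` is `ρ' * V`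
(`IsFlatSource.caputo_volterra`). With `e_m = ρ_* - ρ_m` and `w = 1 - V / K` the iteration therefore
reads `e_{m+1} = 1 * e_m' - e_m' * V / K = w * e_m'`. All derivatives of `ρ_*` vanish at `0`, so
derivatives pass through the convolutions, and `e_m = w * ⋯ * w * ρ_*^{(m)}` with `m` factors `w`.
The bounds on `V` say `0 ≤ w ≤ 1`, hence `|e_m(t)| ≤ sup |ρ_*^{(m)}| t^m / m!`
(`abs_iterationError_le`). With `t ≤ T` and the growth bound this is the claim, and the factorial
beats the powers.

Existence comes directly from Duhamel's formula. That every generated sequence has this form needs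
uniqueness (`IsSolution.unique`), obtained without eigenfunctions. Let `ι : H₀¹ → L²` be the
inclusion, `A = ι*ι`, and let `y` be the time primitive of the difference of two solutions. The
integrated equation is `A y = -(1 - A)(k_α * y)`. Iterating it in exponentially weighted norms makes
`‖Aⁿ y(t)‖` decay faster than every geometric sequence, which for a symmetric `A` forces `A y = 0`
and thus `ι y = 0`. -/

noncomputable section

/-- The Volterra convolution `t ↦ ∫₀ᵗ f (t - s) g(s) ds` on a half line. -/
def volterra {E : Type*} [NormedAddCommGroup E] [NormedSpace ℝ E] (f : ℝ → ℝ) (g : ℝ → E)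
    (t : ℝ) : E :=
  ∫ s in (0 : ℝ)..t, f (t - s) • g s

/-- The Riemann--Liouville kernel `t ^ (a - 1) / Γ(a)`. -/
def rlKernel (a t : ℝ) : ℝ := t ^ (a - 1) / Real.Gamma a

/-! ### Elementary properties of the Volterra convolution. -/

section General

variable {E : Type*} [NormedAddCommGroup E] [NormedSpace ℝ E]

theorem volterra_eq_setIntegral (f : ℝ → ℝ) (g : ℝ → E) {t : ℝ} (ht : 0 ≤ t) :
    volterra f g t = ∫ s in Ioo 0 t, f (t - s) • g s := by
  rw [volterra, intervalIntegral.integral_of_le ht, integral_Ioc_eq_integral_Ioo]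

theorem volterra_congr {f f' : ℝ → ℝ} {g g' : ℝ → E} {t : ℝ} (ht : 0 ≤ t)
    (hf : ∀ s ∈ Ioo 0 t, f s = f' s) (hg : ∀ᵐ s ∂volume.restrict (Ioo 0 t), g s = g' s) :
    volterra f g t = volterra f' g' t := by
  rw [volterra_eq_setIntegral _ _ ht, volterra_eq_setIntegral _ _ ht]
  refine integral_congr_ae ?_
  filter_upwards [hg, ae_restrict_mem measurableSet_Ioo] with s hs hst
  rw [hs, hf (t - s) ⟨by linarith [hst.2], by linarith [hst.1]⟩]

theorem volterra_congr' {f f' : ℝ → ℝ} {g g' : ℝ → E} {t : ℝ} (ht : 0 ≤ t)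
    (hf : ∀ s ∈ Ioo 0 t, f s = f' s) (hg : ∀ s ∈ Ioo 0 t, g s = g' s) :
    volterra f g t = volterra f' g' t :=
  volterra_congr ht hf ((ae_restrict_mem measurableSet_Ioo).mono hg)

theorem volterra_comm (f g : ℝ → ℝ) (t : ℝ) : volterra f g t = volterra g f t := by
  have := intervalIntegral.integral_comp_sub_left (a := 0) (b := t)
    (fun s => f (t - s) • g s) t
  simp only [sub_self, sub_zero, sub_sub_cancel] at this
  rw [volterra, volterra, ← this]
  simp only [smul_eq_mul, mul_comm]

theorem volterra_one (g : ℝ → E) (t : ℝ) : volterra (fun _ => 1) g t = ∫ s in (0 : ℝ)..t, g s := by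
  simp [volterra]

theorem volterra_at_zero (f : ℝ → ℝ) (g : ℝ → E) : volterra f g 0 = 0 := by
  simp [volterra]

theorem ae_restrict_Ioo_mono {p : ℝ → Prop} {t T : ℝ} (htT : t ≤ T)
    (h : ∀ᵐ s ∂volume.restrict (Ioo 0 T), p s) : ∀ᵐ s ∂volume.restrict (Ioo 0 t), p s :=
  ae_restrict_of_ae_restrict_of_subset (Ioo_subset_Ioo_right htT) h

end General

/-! ### Associativity of the Volterra convolution. -/

section Algebra

variable {T : ℝ} {f g h : ℝ → ℝ}

open scoped Convolution

theorem convolution_indicator_eq_zero (f g : ℝ → ℝ) {t : ℝ} (ht : t ≤ 0) :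
    ((Ioo 0 T).indicator f ⋆ (Ioo 0 T).indicator g) t = 0 := by
  rw [convolution_def]
  refine integral_eq_zero_of_ae (Eventually.of_forall fun s => ?_)
  by_cases hs : s ∈ Ioo 0 T
  · have : t - s ∉ Ioo 0 T := fun h => by linarith [h.1, hs.1]
    simp [indicator_of_notMem this]
  · simp [indicator_of_notMem hs]

/-- Cutting off to `(0, T)` gives access to convolutions on the line; causality makes the cutoff
invisible up to time `T`. -/
theorem convolution_indicator_eq_volterra (f g : ℝ → ℝ) {t : ℝ} (ht : t ∈ Icc 0 T) :
    ((Ioo 0 T).indicator f ⋆ (Ioo 0 T).indicator g) t = volterra f g t := by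
  rw [convolution_eq_swap, volterra_eq_setIntegral _ _ ht.1, ← integral_indicator measurableSet_Ioo]
  refine integral_congr_ae (Eventually.of_forall fun s => ?_)
  by_cases hs : s ∈ Ioo 0 t
  · have h1 : s ∈ Ioo 0 T := ⟨hs.1, hs.2.trans_le ht.2⟩
    have h2 : t - s ∈ Ioo 0 T := ⟨by linarith [hs.2], by linarith [hs.1, ht.2]⟩
    simp [indicator_of_mem hs, indicator_of_mem h1, indicator_of_mem h2]
  · simp only [indicator_of_notMem hs]
    by_cases h1 : s ∈ Ioo 0 T
    · have h2 : t - s ∉ Ioo 0 T := fun h => hs ⟨h1.1, by linarith [h.1]⟩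
      simp [indicator_of_notMem h2]
    · simp [indicator_of_notMem h1]

theorem integrable_indicator_Ioo (hf : IntegrableOn f (Ioo 0 T)) :
    Integrable ((Ioo 0 T).indicator f) :=
  (integrable_indicator_iff measurableSet_Ioo).2 hf

theorem ae_integrableOn_volterra_integrand (hf : IntegrableOn f (Ioo 0 T))
    (hg : IntegrableOn g (Ioo 0 T)) : ∀ᵐ t ∂volume.restrict (Ioo 0 T),
      IntegrableOn (fun s => f (t - s) * g s) (Ioo 0 t) := by
  have h := (integrable_indicator_Ioo hf).ae_convolution_exists
    (ContinuousLinearMap.lsmul ℝ ℝ) (integrable_indicator_Ioo hg)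
  filter_upwards [ae_restrict_of_ae h, ae_restrict_mem measurableSet_Ioo] with t ht htT
  have h2 := (ht.integrable_swap).integrableOn (s := Ioo 0 t)
  refine h2.congr_fun (fun s hs => ?_) measurableSet_Ioo
  have h1 : s ∈ Ioo 0 T := ⟨hs.1, hs.2.trans htT.2⟩
  have h2 : t - s ∈ Ioo 0 T := ⟨by linarith [hs.2], by linarith [hs.1, htT.2]⟩
  simp [indicator_of_mem h1, indicator_of_mem h2]

/-- The inner convolution is not cut off at `T`, but `t - s > 0` with `t ≤ T` only sees `s < T`. -/
theorem volterra_volterra_left (f g h : ℝ → ℝ) {t : ℝ} (ht : t ∈ Icc 0 T) :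
    (((Ioo 0 T).indicator f ⋆ (Ioo 0 T).indicator g) ⋆ (Ioo 0 T).indicator h) t =
      volterra (volterra f g) h t := by
  rw [← convolution_indicator_eq_volterra _ _ ht, convolution_def, convolution_def]
  refine integral_congr_ae (Eventually.of_forall fun s => ?_)
  rcases le_or_gt s 0 with hs | hs
  · have : s ∉ Ioo 0 T := fun h => by linarith [h.1]
    simp [convolution_indicator_eq_zero f g hs, indicator_of_notMem this]
  rcases le_or_gt T s with hs2 | hs2
  · have : t - s ∉ Ioo 0 T := fun h => by linarith [h.1, ht.2]
    simp [indicator_of_notMem this]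
  · have : s ∈ Ioo 0 T := ⟨hs, hs2⟩
    simp [indicator_of_mem this, convolution_indicator_eq_volterra f g ⟨hs.le, hs2.le⟩]

/-- For `L¹` functions associativity is only automatic almost everywhere. `H`, the absolute
convergence of the triple convolution at the given `t`, makes it pointwise; one bounded factor
suffices for it, as the next three lemmas show. -/
theorem volterra_assoc_aux (hf : IntegrableOn f (Ioo 0 T)) (hg : IntegrableOn g (Ioo 0 T))
    (hh : IntegrableOn h (Ioo 0 T)) {t : ℝ} (ht : t ∈ Icc 0 T)
    (H : ConvolutionExistsAt (fun x => ‖(Ioo 0 T).indicator f x‖)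
      ((fun x => ‖(Ioo 0 T).indicator g x‖) ⋆[ContinuousLinearMap.mul ℝ ℝ, volume]
        fun x => ‖(Ioo 0 T).indicator h x‖) t (ContinuousLinearMap.mul ℝ ℝ) volume) :
    volterra (volterra f g) h t = volterra f (volterra g h) t := by
  have hf' := integrable_indicator_Ioo hf
  have hg' := integrable_indicator_Ioo hg
  have hh' := integrable_indicator_Ioo hh
  have key := convolution_assoc (ContinuousLinearMap.lsmul ℝ ℝ) (ContinuousLinearMap.lsmul ℝ ℝ)
    (ContinuousLinearMap.lsmul ℝ ℝ) (ContinuousLinearMap.lsmul ℝ ℝ)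
    (fun x y z => by simp [mul_assoc])
    hf'.aestronglyMeasurable hg'.aestronglyMeasurable hh'.aestronglyMeasurable
    (hf'.ae_convolution_exists _ hg') (hg'.norm.ae_convolution_exists _ hh'.norm) H
  rw [volterra_volterra_left _ _ _ ht] at key
  rw [key, volterra_comm, ← volterra_volterra_left _ _ _ ht, ← convolution_flip]
  have e1 : (ContinuousLinearMap.lsmul ℝ ℝ : ℝ →L[ℝ] ℝ →L[ℝ] ℝ).flip =
      ContinuousLinearMap.lsmul ℝ ℝ := by
    ext; simp
  rw [e1]

theorem volterra_assoc_of_bounded_left (hf : IntegrableOn f (Ioo 0 T))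
    (hg : IntegrableOn g (Ioo 0 T)) (hh : IntegrableOn h (Ioo 0 T)) {C : ℝ}
    (hC : ∀ t ∈ Ioo 0 T, |f t| ≤ C) {t : ℝ} (ht : t ∈ Icc 0 T) :
    volterra (volterra f g) h t = volterra f (volterra g h) t := by
  refine volterra_assoc_aux hf hg hh ht ?_
  have hf' := integrable_indicator_Ioo hf
  have hg' := integrable_indicator_Ioo hg
  have hh' := integrable_indicator_Ioo hh
  rw [convolutionExistsAt_iff_integrable_swap]
  refine Integrable.bdd_mul (c := |C|)
    (hg'.norm.integrable_convolution (ContinuousLinearMap.mul ℝ ℝ) hh'.norm) ?_ ?_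
  · exact (hf'.norm.comp_sub_left t).aestronglyMeasurable
  · refine Eventually.of_forall fun s => ?_
    rw [norm_norm]
    by_cases hs : t - s ∈ Ioo 0 T
    · rw [indicator_of_mem hs]; exact (hC _ hs).trans (le_abs_self C)
    · simp [indicator_of_notMem hs]

theorem volterra_assoc_of_bounded_right (hf : IntegrableOn f (Ioo 0 T))
    (hg : IntegrableOn g (Ioo 0 T)) (hh : IntegrableOn h (Ioo 0 T)) {C : ℝ}
    (hC : ∀ t ∈ Ioo 0 T, |h t| ≤ C) {t : ℝ} (ht : t ∈ Icc 0 T) :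
    volterra (volterra f g) h t = volterra f (volterra g h) t := by
  have := volterra_assoc_of_bounded_left hh hg hf hC ht
  rw [volterra_comm _ h, volterra_comm f, ← volterra_congr' ht.1 (fun s _ => volterra_comm h g s)
    (fun s _ => rfl), this]
  exact volterra_congr' ht.1 (fun s _ => rfl) (fun s _ => volterra_comm _ _ s)

/-- This covers products such as `k_α * 1 * k_{1-α}`, where both outer factors are singular: `|g| *
|h|` is bounded by `|C| ‖h‖₁`. -/
theorem volterra_assoc_of_bounded_middle (hf : IntegrableOn f (Ioo 0 T))
    (hg : IntegrableOn g (Ioo 0 T)) (hh : IntegrableOn h (Ioo 0 T)) {C : ℝ}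
    (hC : ∀ t ∈ Ioo 0 T, |g t| ≤ C) {t : ℝ} (ht : t ∈ Icc 0 T) :
    volterra (volterra f g) h t = volterra f (volterra g h) t := by
  refine volterra_assoc_aux hf hg hh ht ?_
  have hf' := integrable_indicator_Ioo hf
  have hg' := integrable_indicator_Ioo hg
  have hh' := integrable_indicator_Ioo hh
  have hb : ∀ x, ‖(Ioo 0 T).indicator g x‖ ≤ |C| := fun x => by
    by_cases hs : x ∈ Ioo 0 T
    · rw [indicator_of_mem hs]; exact (hC _ hs).trans (le_abs_self C)
    · simp [indicator_of_notMem hs]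
  have hi : Integrable (((fun x => ‖(Ioo 0 T).indicator g x‖) ⋆[ContinuousLinearMap.mul ℝ ℝ, volume]
        fun x => ‖(Ioo 0 T).indicator h x‖)) :=
    hg'.norm.integrable_convolution (ContinuousLinearMap.mul ℝ ℝ) hh'.norm
  rw [ConvolutionExistsAt]
  refine Integrable.mul_bdd (c := |C| * ∫ x, ‖(Ioo 0 T).indicator h x‖) hf'.norm
    (hi.comp_sub_left t).aestronglyMeasurable (Eventually.of_forall fun s => ?_)
  rw [convolution_eq_swap, ← integral_const_mul]
  refine norm_integral_le_of_norm_le (hh'.norm.const_mul _) (Eventually.of_forall fun x => ?_)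
  simp only [ContinuousLinearMap.mul_apply', norm_mul, norm_norm]
  exact mul_le_mul_of_nonneg_right (hb _) (norm_nonneg _)

end Algebra

/-! ### Riemann–Liouville kernels. -/

section Kernel

theorem integrableOn_rlKernel {a : ℝ} (ha : 0 < a) (T : ℝ) :
    IntegrableOn (rlKernel a) (Ioo 0 T) := by
  rcases le_or_gt T 0 with h | h
  · simp [Ioo_eq_empty_of_le h]
  · have : IntervalIntegrable (fun x : ℝ => x ^ (a - 1)) volume 0 T :=
      intervalIntegral.intervalIntegrable_rpow' (by linarith)
    exact (((intervalIntegrable_iff_integrableOn_Ioo_of_le h.le).1 this).div_const _)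

theorem rlKernel_one (t : ℝ) : rlKernel 1 t = 1 := by simp [rlKernel]

theorem rlKernel_nonneg {a t : ℝ} (ha : 0 < a) (ht : 0 ≤ t) : 0 ≤ rlKernel a t :=
  div_nonneg (Real.rpow_nonneg ht _) (Real.Gamma_pos_of_pos ha).le

/-- The semigroup law of fractional integration, which is Euler's Beta integral rescaled to `(0,
t)`. -/
theorem volterra_rlKernel_rlKernel {a b t : ℝ} (ha : 0 < a) (hb : 0 < b) (ht : 0 < t) :
    volterra (rlKernel a) (rlKernel b) t = rlKernel (a + b) t := by
  have h1 := Complex.betaIntegral_scaled (b : ℂ) (a : ℂ) ht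
  have hB : Complex.betaIntegral b a =
      ((Real.Gamma b * Real.Gamma a / Real.Gamma (b + a) : ℝ) : ℂ) := by
    rw [Complex.betaIntegral_eq_Gamma_mul_div _ _ (by simpa) (by simpa)]
    push_cast [← Complex.Gamma_ofReal]
    rfl
  have h2 : (∫ x in (0 : ℝ)..t, (x : ℂ) ^ ((b : ℂ) - 1) * ((t : ℂ) - x) ^ ((a : ℂ) - 1)) =
      ((∫ x in (0 : ℝ)..t, x ^ (b - 1) * (t - x) ^ (a - 1) : ℝ) : ℂ) := by
    rw [← intervalIntegral.integral_ofReal, intervalIntegral.integral_of_le ht.le,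
      intervalIntegral.integral_of_le ht.le]
    refine setIntegral_congr_fun measurableSet_Ioc fun x hx => ?_
    rw [Complex.ofReal_mul, Complex.ofReal_cpow hx.1.le, Complex.ofReal_cpow (by linarith [hx.2])]
    push_cast
    rfl
  have h3 : ((t : ℂ)) ^ ((b : ℂ) + a - 1) = ((t ^ (b + a - 1) : ℝ) : ℂ) := by
    rw [Complex.ofReal_cpow ht.le]; push_cast; rfl
  rw [h2, hB, h3, ← Complex.ofReal_mul, Complex.ofReal_inj] at h1
  have h4 : volterra (rlKernel a) (rlKernel b) t =
      (∫ x in (0 : ℝ)..t, x ^ (b - 1) * (t - x) ^ (a - 1)) * (1 / (Real.Gamma a * Real.Gamma b)) := by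
    rw [volterra, ← intervalIntegral.integral_mul_const]
    refine intervalIntegral.integral_congr fun x _ => ?_
    simp only [rlKernel, smul_eq_mul]
    field_simp
  have := (Real.Gamma_pos_of_pos ha).ne'
  have := (Real.Gamma_pos_of_pos hb).ne'
  rw [h4, h1, rlKernel, add_comm b a]
  field_simp

/-- The Laplace transform of `rlKernel a` at `l` is `l ^ (-a)`; truncating its integral at `t` only
decreases it. The small factor for large `l` drives the uniqueness proof. -/
theorem volterra_rlKernel_exp_le {a l t : ℝ} (ha : 0 < a) (hl : 0 < l) (ht : 0 ≤ t) :
    volterra (rlKernel a) (fun s => Real.exp (l * s)) t ≤ l ^ (-a) * Real.exp (l * t) := by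
  rw [volterra_comm, volterra_eq_setIntegral _ _ ht]
  have hΓ := Real.Gamma_pos_of_pos ha
  have h0 := Real.integral_rpow_mul_exp_neg_mul_Ioi ha hl
  -- A non-integrable function would have integral `0` by convention, but the Gamma integral is
  -- positive.
  have hint : IntegrableOn (fun s : ℝ => s ^ (a - 1) * Real.exp (-(l * s))) (Ioi 0) := by
    by_contra hcon
    have h1 : 0 < (1 / l) ^ a * Real.Gamma a := by positivity
    rw [← h0, integral_undef hcon] at h1
    exact lt_irrefl _ h1
  calc ∫ s in Ioo 0 t, Real.exp (l * (t - s)) • rlKernel a s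
      = ∫ s in Ioo 0 t, (Real.exp (l * t) / Real.Gamma a) * (s ^ (a - 1) * Real.exp (-(l * s))) := by
        refine setIntegral_congr_fun measurableSet_Ioo fun s _ => ?_
        simp only [rlKernel, smul_eq_mul]
        rw [mul_sub, sub_eq_add_neg, Real.exp_add]
        ring
    _ = (Real.exp (l * t) / Real.Gamma a) * ∫ s in Ioo 0 t, (s ^ (a - 1) * Real.exp (-(l * s))) :=
        integral_const_mul _ _
    _ ≤ (Real.exp (l * t) / Real.Gamma a) * ∫ s in Ioi 0, (s ^ (a - 1) * Real.exp (-(l * s))) := by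
        refine mul_le_mul_of_nonneg_left (setIntegral_mono_set hint ?_ ?_) (by positivity)
        · filter_upwards [ae_restrict_mem measurableSet_Ioi] with s hs
          have : (0 : ℝ) < s := hs
          positivity
        · exact (Ioo_subset_Ioi_self).eventuallyLE
    _ = l ^ (-a) * Real.exp (l * t) := by
        rw [h0, one_div, Real.inv_rpow hl.le, Real.rpow_neg hl.le]
        field_simp

theorem caputo_eq_volterra (α : ℝ) (f : ℝ → ℝ) (t : ℝ) (ht : 0 ≤ t) :
    caputo α f t = volterra (rlKernel (1 - α)) (deriv f) t := by
  rw [caputo, volterra, ← intervalIntegral.integral_const_mul, intervalIntegral.integral_of_le ht,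
    intervalIntegral.integral_of_le ht]
  refine setIntegral_congr_fun measurableSet_Ioc fun s hs => ?_
  simp only [rlKernel, smul_eq_mul]
  rw [show (1 : ℝ) - α - 1 = -α by ring, Real.rpow_neg (by linarith [hs.2])]
  ring

end Kernel
end

noncomputable section

/-! ### Continuity of Volterra convolutions in time. -/

section Continuity

variable {E : Type*} [NormedAddCommGroup E] [NormedSpace ℝ E]

theorem continuousOn_volterra {T : ℝ} (hT : 0 ≤ T) {f : ℝ → ℝ} {g : ℝ → E}
    (hf : ContinuousOn f (Icc 0 T)) (hg : IntegrableOn g (Ioo 0 T)) :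
    ContinuousOn (volterra f g) (Icc 0 T) := by
  obtain ⟨C, hC⟩ := isCompact_Icc.exists_bound_of_continuousOn hf
  set F : ℝ → ℝ := fun t => f (projIcc 0 T hT t) with hF
  have hFc : Continuous F := by
    rw [continuousOn_iff_continuous_domRestrict] at hf
    exact hf.comp continuous_projIcc
  have hFC : ∀ t, ‖F t‖ ≤ C := fun t => hC _ (projIcc 0 T hT t).2
  have hFf : ∀ t ∈ Icc 0 T, F t = f t := fun t ht => by rw [hF]; simp [projIcc_of_mem hT ht]
  -- The indicator fixes the domain of integration, so dominated convergence applies; at `t₀` it is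
  -- discontinuous in `t` only for the null set `s = t₀`.
  have key : Continuous fun t => ∫ s in Ioo 0 T, (Iio t).indicator (fun s => F (t - s) • g s) s := by
    refine continuous_iff_continuousAt.2 fun t₀ => ?_
    refine continuousAt_of_dominated (bound := fun s => C * ‖g s‖) ?_ ?_ (hg.norm.const_mul C) ?_
    · refine Eventually.of_forall fun t => AEStronglyMeasurable.indicator ?_ measurableSet_Iio
      exact (hFc.comp (continuous_const.sub continuous_id)).aestronglyMeasurable.smul
        hg.aestronglyMeasurable
    · refine Eventually.of_forall fun t => Eventually.of_forall fun s => ?_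
      refine (norm_indicator_le_norm_self _ _).trans ?_
      rw [norm_smul]
      exact mul_le_mul_of_nonneg_right (hFC _) (norm_nonneg _)
    · have : ∀ᵐ s ∂volume.restrict (Ioo 0 T), s ≠ t₀ :=
        ae_restrict_of_ae (Measure.ae_ne volume t₀)
      filter_upwards [this] with s hs
      rcases lt_or_gt_of_ne hs with h | h
      · have h1 : ContinuousAt (fun t => F (t - s) • g s) t₀ := by fun_prop
        refine h1.congr ?_
        filter_upwards [lt_mem_nhds h] with t ht
        rw [indicator_of_mem (show s ∈ Iio t from ht)]
      · refine (continuousAt_const (y := (0 : E))).congr ?_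
        filter_upwards [gt_mem_nhds h] with t ht
        rw [indicator_of_notMem (fun h' : s ∈ Iio t => lt_asymm ht h')]
  refine key.continuousOn.congr fun t ht => ?_
  beta_reduce
  rw [volterra_eq_setIntegral _ _ ht.1, setIntegral_indicator measurableSet_Iio]
  have : Ioo 0 T ∩ Iio t = Ioo 0 t := by
    ext s; simp only [mem_inter_iff, mem_Ioo, mem_Iio]
    exact ⟨fun h => ⟨h.1.1, h.2⟩, fun h => ⟨⟨h.1, h.2.trans_le ht.2⟩, h.2⟩⟩
  rw [this]
  refine setIntegral_congr_fun measurableSet_Ioo fun s hs => ?_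
  rw [hFf _ ⟨by linarith [hs.2], by linarith [hs.1, ht.2]⟩]

theorem continuousOn_integral_of_integrableOn {T : ℝ} (hT : 0 ≤ T) {g : ℝ → E}
    (hg : IntegrableOn g (Ioo 0 T)) :
    ContinuousOn (fun t => ∫ s in (0 : ℝ)..t, g s) (Icc 0 T) := by
  have := continuousOn_volterra hT (f := fun _ => 1) continuousOn_const hg
  exact this.congr fun t _ => (volterra_one g t).symm

end Continuity

/-! ### Calculus of the Caputo derivative. -/

section Caputo

variable {T α : ℝ} {F G h : ℝ → ℝ}

theorem ContinuousOn.integrableOn_Ioo_of_Icc (hF : ContinuousOn F (Icc 0 T)) :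
    IntegrableOn F (Ioo 0 T) :=
  hF.integrableOn_Icc.mono_set Ioo_subset_Icc_self

theorem ContinuousOn.exists_bound_Ioo (hF : ContinuousOn F (Icc 0 T)) :
    ∃ C, ∀ t ∈ Ioo 0 T, |F t| ≤ C := by
  obtain ⟨C, hC⟩ := isCompact_Icc.exists_bound_of_continuousOn hF
  exact ⟨C, fun t ht => hC t (Ioo_subset_Icc_self ht)⟩

theorem MeasureTheory.IntegrableOn.intervalIntegrable_zero {E : Type*}
    [NormedAddCommGroup E] {g : ℝ → E}
    (hg : IntegrableOn g (Ioo 0 T)) {t : ℝ} (ht : t ∈ Icc 0 T) :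
    IntervalIntegrable g volume 0 t :=
  (intervalIntegrable_iff_integrableOn_Ioo_of_le ht.1).2
    (hg.mono_set (Ioo_subset_Ioo_right ht.2))

theorem hasDerivAt_of_eq_integral (hG : ContinuousOn G (Icc 0 T))
    (hF : ∀ t ∈ Icc 0 T, F t = ∫ s in (0 : ℝ)..t, G s) {t : ℝ} (ht : t ∈ Ioo 0 T) :
    HasDerivAt F (G t) t := by
  have h1 : HasDerivAt (fun t => ∫ s in (0 : ℝ)..t, G s) (G t) t := by
    refine intervalIntegral.integral_hasDerivAt_right
      (hG.integrableOn_Ioo_of_Icc.intervalIntegrable_zero ⟨ht.1.le, ht.2.le⟩) ?_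
      (hG.continuousAt (Icc_mem_nhds ht.1 ht.2))
    exact (hG.mono Ioo_subset_Icc_self).stronglyMeasurableAtFilter isOpen_Ioo t ht
  refine h1.congr_of_eventuallyEq ?_
  filter_upwards [Ioo_mem_nhds ht.1 ht.2] with s hs
  exact hF s ⟨hs.1.le, hs.2.le⟩

theorem caputoAdmissible_of_eq_integral (hT : 0 ≤ T) (hG : ContinuousOn G (Icc 0 T))
    (hF : ∀ t ∈ Icc 0 T, F t = ∫ s in (0 : ℝ)..t, G s) : CaputoAdmissible T F := by
  refine ⟨?_, fun t ht => ?_, ?_⟩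
  · exact (continuousOn_integral_of_integrableOn hT hG.integrableOn_Ioo_of_Icc).congr hF
  · exact (hasDerivAt_of_eq_integral hG hF ht).differentiableAt.differentiableWithinAt
  · refine hG.integrableOn_Ioo_of_Icc.congr_fun (fun t ht => ?_) measurableSet_Ioo
    exact (hasDerivAt_of_eq_integral hG hF ht).deriv.symm

theorem CaputoAdmissible.eq_add_integral (hF : CaputoAdmissible T F) {t : ℝ} (ht : t ∈ Icc 0 T) :
    F t = F 0 + ∫ s in (0 : ℝ)..t, deriv F s := by
  rw [intervalIntegral.integral_eq_sub_of_hasDerivAt_of_le ht.1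
    (hF.1.mono (Icc_subset_Icc_right ht.2)) (fun s hs => ?_)
    (hF.2.2.intervalIntegrable_zero ht)]
  · ring
  · have hs' : s ∈ Ioo 0 T := ⟨hs.1, hs.2.trans_le ht.2⟩
    exact (hF.2.1.differentiableAt (Ioo_mem_nhds hs'.1 hs'.2)).hasDerivAt

theorem deriv_eq_of_eqOn_Ioo (h : ∀ t ∈ Ioo 0 T, F t = G t) {t : ℝ} (ht : t ∈ Ioo 0 T) :
    deriv F t = deriv G t :=
  Filter.EventuallyEq.deriv_eq (by filter_upwards [Ioo_mem_nhds ht.1 ht.2] using h)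

theorem caputo_congr (h : ∀ t ∈ Ioo 0 T, F t = G t) {t : ℝ} (ht : t ∈ Icc 0 T) :
    caputo α F t = caputo α G t := by
  rw [caputo_eq_volterra _ _ _ ht.1, caputo_eq_volterra _ _ _ ht.1]
  exact volterra_congr' ht.1 (fun _ _ => rfl)
    fun s hs => deriv_eq_of_eqOn_Ioo h ⟨hs.1, hs.2.trans_le ht.2⟩

theorem CaputoAdmissible.congr (hF : CaputoAdmissible T F) (h : ∀ t ∈ Icc 0 T, F t = G t) :
    CaputoAdmissible T G := by
  refine ⟨hF.1.congr fun t ht => (h t ht).symm, hF.2.1.congr fun t ht =>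
    (h t (Ioo_subset_Icc_self ht)).symm, hF.2.2.congr_fun (fun t ht => ?_) measurableSet_Ioo⟩
  exact deriv_eq_of_eqOn_Ioo (fun t ht => h t (Ioo_subset_Icc_self ht)) ht

theorem CaputoAdmissible.deriv_sub (hF : CaputoAdmissible T F) (hG : CaputoAdmissible T G)
    {t : ℝ} (ht : t ∈ Ioo 0 T) : deriv (fun s => F s - G s) t = deriv F t - deriv G t :=
  deriv_fun_sub (hF.2.1.differentiableAt (Ioo_mem_nhds ht.1 ht.2))
    (hG.2.1.differentiableAt (Ioo_mem_nhds ht.1 ht.2))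

theorem CaputoAdmissible.sub (hF : CaputoAdmissible T F) (hG : CaputoAdmissible T G) :
    CaputoAdmissible T (fun t => F t - G t) :=
  ⟨hF.1.sub hG.1, hF.2.1.sub hG.2.1, (hF.2.2.sub hG.2.2).congr_fun
    (fun _ ht => (hF.deriv_sub hG ht).symm) measurableSet_Ioo⟩

/-- Linearity only holds almost everywhere: with derivatives merely in `L¹`, the singular integrals
may diverge at some times. -/
theorem caputo_sub_ae (hα : α < 1) (hF : CaputoAdmissible T F) (hG : CaputoAdmissible T G) :
    ∀ᵐ t ∂volume.restrict (Ioo 0 T),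
      caputo α (fun t => F t - G t) t = caputo α F t - caputo α G t := by
  have hk := integrableOn_rlKernel (a := 1 - α) (by linarith) T
  filter_upwards [ae_integrableOn_volterra_integrand hk hF.2.2,
    ae_integrableOn_volterra_integrand hk hG.2.2, ae_restrict_mem measurableSet_Ioo]
    with t h1 h2 ht
  simp only [caputo_eq_volterra _ _ _ ht.1.le, volterra_eq_setIntegral _ _ ht.1.le, smul_eq_mul]
  rw [← integral_sub h1 h2]
  refine setIntegral_congr_fun measurableSet_Ioo fun s hs => ?_
  rw [hF.deriv_sub hG ⟨hs.1, hs.2.trans ht.2⟩, mul_sub]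

theorem rlKernel_compl {t : ℝ} (hα0 : 0 < α) (hα1 : α < 1) (ht : 0 < t) :
    volterra (rlKernel (1 - α)) (rlKernel α) t = 1 := by
  rw [volterra_rlKernel_rlKernel (by linarith) hα0 ht, show 1 - α + α = 1 by ring, rlKernel_one]

theorem volterra_neg (f g : ℝ → ℝ) (t : ℝ) : volterra f (fun s => -g s) t = -volterra f g t := by
  simp [volterra]

/-- The integrated form of `∂_t^α F = -h`, `F(0) = 0`. -/
theorem integral_eq_neg_volterra (hα0 : 0 < α) (hα1 : α < 1)
    (hF : CaputoAdmissible T F) (hF0 : F 0 = 0)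
    (hFh : ∀ᵐ t ∂volume.restrict (Ioo 0 T), caputo α F t + h t = 0) {t : ℝ} (ht : t ∈ Icc 0 T) :
    ∫ s in (0 : ℝ)..t, F s = -volterra (rlKernel α) (fun s => ∫ r in (0 : ℝ)..s, h r) t := by
  have hT : 0 ≤ T := ht.1.trans ht.2
  have hk := integrableOn_rlKernel hα0 T
  have hk' := integrableOn_rlKernel (a := 1 - α) (by linarith) T
  have h1 : ContinuousOn (fun _ : ℝ => (1 : ℝ)) (Icc 0 T) := continuousOn_const
  have hb1 : ∀ t ∈ Ioo 0 T, |(fun _ : ℝ => (1 : ℝ)) t| ≤ 1 := by simp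
  have h1i := h1.integrableOn_Ioo_of_Icc
  have hkk := continuousOn_volterra hT h1 hk'
  obtain ⟨C, hC⟩ := hkk.exists_bound_Ioo
  have hh : ∀ s ∈ Icc 0 T, ∫ r in (0 : ℝ)..s, h r =
      -volterra (volterra (fun _ => 1) (rlKernel (1 - α))) (deriv F) s := by
    intro s hs
    rw [volterra_assoc_of_bounded_left h1i hk' hF.2.2 hb1 hs, ← volterra_neg, ← volterra_one]
    refine volterra_congr hs.1 (fun _ _ => rfl) ?_
    filter_upwards [ae_restrict_Ioo_mono hs.2 hFh, ae_restrict_mem measurableSet_Ioo] with r hr hr'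
    rw [← caputo_eq_volterra _ _ _ hr'.1.le]
    linarith
  -- With `1 * h = -(1 * k_{1-α}) * F'`, convolving by `k_α` leaves `-(1 * 1) * F' = -(1 * F)`. The
  -- extra integration supplies a bounded factor for every regrouping.
  have hkkk : ∀ s ∈ Icc 0 T, volterra (rlKernel α) (volterra (fun _ => 1) (rlKernel (1 - α))) s =
      volterra (fun _ => 1) (fun _ => 1) s := by
    intro s hs
    rw [← volterra_assoc_of_bounded_middle hk h1i hk' hb1 hs,
      volterra_congr' hs.1 (fun r _ => volterra_comm _ _ r) (fun _ _ => rfl),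
      volterra_assoc_of_bounded_left h1i hk hk' hb1 hs]
    refine volterra_congr' hs.1 (fun _ _ => rfl) fun r hr => ?_
    rw [volterra_comm, rlKernel_compl hα0 hα1 hr.1]
  rw [volterra_congr' ht.1 (fun _ _ => rfl) (fun s hs => hh s ⟨hs.1.le, hs.2.le.trans ht.2⟩),
    volterra_neg, neg_neg, ← volterra_assoc_of_bounded_middle hk hkk.integrableOn_Ioo_of_Icc hF.2.2 hC ht,
    volterra_congr' ht.1 (fun s hs => hkkk s ⟨hs.1.le, hs.2.le.trans ht.2⟩) (fun _ _ => rfl),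
    volterra_assoc_of_bounded_left h1i h1i hF.2.2 hb1 ht, ← volterra_one]
  refine volterra_congr' ht.1 (fun _ _ => rfl) fun s hs => ?_
  rw [hF.eq_add_integral ⟨hs.1.le, hs.2.le.trans ht.2⟩, hF0, zero_add, volterra_one]

end Caputo

/-! ### Duhamel's formula for scalar functions of time. -/

/-- A source `ρ` on `[0, T]` that is twice continuously differentiable with derivatives `ρ₁`, `ρ₂`,
and satisfies `ρ(0) = ρ'(0) = 0`. -/
structure IsFlatSource (T : ℝ) (ρ ρ₁ ρ₂ : ℝ → ℝ) : Prop where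
  continuousOn_one : ContinuousOn ρ₁ (Icc 0 T)
  continuousOn_two : ContinuousOn ρ₂ (Icc 0 T)
  eq_integral : ∀ t ∈ Icc 0 T, ρ t = ∫ s in (0 : ℝ)..t, ρ₁ s
  one_eq_integral : ∀ t ∈ Icc 0 T, ρ₁ t = ∫ s in (0 : ℝ)..t, ρ₂ s

namespace IsFlatSource

variable {T α : ℝ} {ρ ρ₁ ρ₂ : ℝ → ℝ} {G h : ℝ → ℝ}

theorem continuousOn_volterra_rlKernel (hT : 0 ≤ T) (hα0 : 0 < α)
    (hρ : ContinuousOn ρ (Icc 0 T)) : ContinuousOn (volterra (rlKernel α) ρ) (Icc 0 T) :=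
  (continuousOn_volterra hT hρ (integrableOn_rlKernel hα0 T)).congr
    fun t _ => volterra_comm _ _ t

theorem volterra_rlKernel_eq (hρ : IsFlatSource T ρ ρ₁ ρ₂) (hα0 : 0 < α) {t : ℝ}
    (ht : t ∈ Icc 0 T) :
    volterra (rlKernel α) ρ₁ t = volterra (fun _ => 1) (volterra (rlKernel α) ρ₂) t := by
  have hk := integrableOn_rlKernel hα0 T
  have h1i : IntegrableOn (fun _ : ℝ => (1 : ℝ)) (Ioo 0 T) := continuousOn_const.integrableOn_Ioo_of_Icc
  have hb1 : ∀ t ∈ Ioo 0 T, |(fun _ : ℝ => (1 : ℝ)) t| ≤ 1 := by simp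
  have h2 := hρ.continuousOn_two.integrableOn_Ioo_of_Icc
  rw [← volterra_assoc_of_bounded_left h1i hk h2 hb1 ht,
    volterra_congr' ht.1 (fun r _ => volterra_comm _ (rlKernel α) r) (fun _ _ => rfl),
    volterra_assoc_of_bounded_middle hk h1i h2 hb1 ht]
  refine volterra_congr' ht.1 (fun _ _ => rfl) fun s hs => ?_
  rw [hρ.one_eq_integral s ⟨hs.1.le, hs.2.le.trans ht.2⟩, volterra_one]

theorem volterra_compl (hα0 : 0 < α) (hα1 : α < 1) (hρ : ContinuousOn ρ (Icc 0 T)) {t : ℝ}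
    (ht : t ∈ Icc 0 T) :
    volterra (rlKernel (1 - α)) (volterra (rlKernel α) ρ) t = ∫ s in (0 : ℝ)..t, ρ s := by
  obtain ⟨C, hC⟩ := hρ.exists_bound_Ioo
  rw [← volterra_assoc_of_bounded_right (integrableOn_rlKernel (by linarith) T)
    (integrableOn_rlKernel hα0 T) hρ.integrableOn_Ioo_of_Icc hC ht, ← volterra_one]
  exact volterra_congr' ht.1 (fun s hs => rlKernel_compl hα0 hα1 hs.1) (fun _ _ => rfl)

/-- Both derivatives fall on `ρ`, so `G` need only be continuous. This matters for `G = v(x₀, ·)`,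
about which no differentiability in time is known. -/
theorem volterra_eq_integral (hρ : IsFlatSource T ρ ρ₁ ρ₂) (hα0 : 0 < α)
    (hG : ContinuousOn G (Icc 0 T)) {t : ℝ} (ht : t ∈ Icc 0 T) :
    volterra (volterra (rlKernel α) ρ₁) G t =
      ∫ s in (0 : ℝ)..t, volterra (volterra (rlKernel α) ρ₂) G s := by
  have hT : 0 ≤ T := ht.1.trans ht.2
  have hθ := continuousOn_volterra_rlKernel hT hα0 hρ.continuousOn_two
  rw [volterra_congr' ht.1 (fun s hs => hρ.volterra_rlKernel_eq hα0 ⟨hs.1.le, hs.2.le.trans ht.2⟩)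
    (fun _ _ => rfl), volterra_assoc_of_bounded_left (C := 1) continuousOn_const.integrableOn_Ioo_of_Icc
    hθ.integrableOn_Ioo_of_Icc hG.integrableOn_Ioo_of_Icc (by simp) ht, volterra_one]

theorem caputoAdmissible (hρ : IsFlatSource T ρ ρ₁ ρ₂) (hT : 0 ≤ T) (hα0 : 0 < α)
    (hG : ContinuousOn G (Icc 0 T)) :
    CaputoAdmissible T (volterra (volterra (rlKernel α) ρ₁) G) :=
  caputoAdmissible_of_eq_integral hT (continuousOn_volterra hT
    (continuousOn_volterra_rlKernel hT hα0 hρ.continuousOn_two) hG.integrableOn_Ioo_of_Icc)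
    fun _ ht => hρ.volterra_eq_integral hα0 hG ht

theorem caputo_volterra (hρ : IsFlatSource T ρ ρ₁ ρ₂) (hα0 : 0 < α) (hα1 : α < 1)
    (hG : ContinuousOn G (Icc 0 T)) {t : ℝ} (ht : t ∈ Icc 0 T) :
    caputo α (volterra (volterra (rlKernel α) ρ₁) G) t = volterra ρ₁ G t := by
  have hT : 0 ≤ T := ht.1.trans ht.2
  have hθ := continuousOn_volterra_rlKernel hT hα0 hρ.continuousOn_two
  obtain ⟨C, hC⟩ := hG.exists_bound_Ioo
  rw [caputo_eq_volterra _ _ _ ht.1]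
  rw [volterra_congr' ht.1 (fun _ _ => rfl) (fun s hs => (hasDerivAt_of_eq_integral
    (continuousOn_volterra hT hθ hG.integrableOn_Ioo_of_Icc)
    (fun _ ht => hρ.volterra_eq_integral hα0 hG ht) ⟨hs.1, hs.2.trans_le ht.2⟩).deriv),
    ← volterra_assoc_of_bounded_right (integrableOn_rlKernel (by linarith) T)
      hθ.integrableOn_Ioo_of_Icc hG.integrableOn_Ioo_of_Icc hC ht]
  refine volterra_congr' ht.1 (fun s hs => ?_) (fun _ _ => rfl)
  have hs' : s ∈ Icc 0 T := ⟨hs.1.le, hs.2.le.trans ht.2⟩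
  rw [volterra_compl hα0 hα1 hρ.continuousOn_two hs', hρ.one_eq_integral s hs']

/-- Duhamel's principle, tested against a fixed functional. -/
theorem caputo_volterra_add (hρ : IsFlatSource T ρ ρ₁ ρ₂) (hα0 : 0 < α) (hα1 : α < 1)
    (hG : CaputoAdmissible T G)
    (hh : ∀ᵐ t ∂volume.restrict (Ioo 0 T), caputo α G t + h t = 0) {t : ℝ} (ht : t ∈ Icc 0 T) :
    caputo α (volterra (volterra (rlKernel α) ρ₁) G) t +
      volterra (volterra (rlKernel α) ρ₁) h t = ρ t * G 0 := by
  have hT : 0 ≤ T := ht.1.trans ht.2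
  have hk' := integrableOn_rlKernel (a := 1 - α) (by linarith) T
  have h1i : IntegrableOn (fun _ : ℝ => (1 : ℝ)) (Ioo 0 T) := continuousOn_const.integrableOn_Ioo_of_Icc
  have hb1 : ∀ t ∈ Ioo 0 T, |(fun _ : ℝ => (1 : ℝ)) t| ≤ 1 := by simp
  have hθ := continuousOn_volterra_rlKernel hT hα0 hρ.continuousOn_one
  obtain ⟨C, hC⟩ := hθ.exists_bound_Ioo
  have hρ1 := hρ.continuousOn_one
  have hρt : ContinuousOn (fun s => ρ₁ (t - s)) (Icc 0 t) :=
    hρ1.comp (by fun_prop) fun s hs => ⟨by linarith [hs.2], by linarith [hs.1, ht.2]⟩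
  have hGI := continuousOn_integral_of_integrableOn hT hG.2.2
  -- Integration by parts, from `G = G(0) + 1 * G'` and `ρ₁ * 1 = ρ`.
  have e1 : volterra ρ₁ G t = ρ t * G 0 + volterra ρ (deriv G) t := by
    have a1 : volterra ρ₁ G t = volterra ρ₁ (fun _ => G 0) t +
        volterra ρ₁ (volterra (fun _ => 1) (deriv G)) t := by
      rw [volterra, volterra, volterra, ← intervalIntegral.integral_add]
      · refine intervalIntegral.integral_congr fun s hs => ?_
        rw [uIcc_of_le ht.1] at hs
        simp only [volterra_one, ← smul_add]
        rw [← hG.eq_add_integral ⟨hs.1, hs.2.trans ht.2⟩]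
      · refine ContinuousOn.intervalIntegrable ?_
        rw [uIcc_of_le ht.1]
        exact hρt.mul continuousOn_const
      · refine ContinuousOn.intervalIntegrable ?_
        rw [uIcc_of_le ht.1]
        simp only [volterra_one]
        exact hρt.mul (hGI.mono (Icc_subset_Icc_right ht.2))
    rw [a1, ← volterra_assoc_of_bounded_middle hρ1.integrableOn_Ioo_of_Icc h1i hG.2.2 hb1 ht]
    congr 1
    · rw [volterra_comm, hρ.eq_integral t ht, volterra]
      simp [mul_comm]
    · refine volterra_congr' ht.1 (fun s hs => ?_) (fun _ _ => rfl)
      rw [volterra_comm, volterra_one, hρ.eq_integral s ⟨hs.1.le, hs.2.le.trans ht.2⟩]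
  -- The equation gives `h = -k_{1-α} * G'`, and `k_α * ρ₁ * k_{1-α} = 1 * ρ₁ = ρ`.
  have e2 : volterra (volterra (rlKernel α) ρ₁) h t = -volterra ρ (deriv G) t := by
    have : volterra ρ (deriv G) t = volterra (volterra (volterra (rlKernel α) ρ₁)
        (rlKernel (1 - α))) (deriv G) t := by
      refine volterra_congr' ht.1 (fun s hs => ?_) (fun _ _ => rfl)
      have hs' : s ∈ Icc 0 T := ⟨hs.1.le, hs.2.le.trans ht.2⟩
      rw [volterra_comm, volterra_compl hα0 hα1 hρ1 hs', hρ.eq_integral s hs']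
    rw [this, volterra_assoc_of_bounded_left hθ.integrableOn_Ioo_of_Icc hk' hG.2.2 hC ht, ← volterra_neg]
    refine volterra_congr ht.1 (fun _ _ => rfl) ?_
    filter_upwards [ae_restrict_Ioo_mono ht.2 hh, ae_restrict_mem measurableSet_Ioo] with r hr hr'
    rw [← caputo_eq_volterra _ _ _ hr'.1.le]
    linarith
  rw [hρ.caputo_volterra hα0 hα1 hG.1 ht, e1, e2]
  ring

end IsFlatSource
end

noncomputable section

/-! ### Abstract uniqueness for a symmetric operator. -/

section Operator

variable {X : Type*} [NormedAddCommGroup X] [InnerProductSpace ℝ X]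

open scoped RealInnerProductSpace

/-- For a symmetric operator the norms `‖Aⁿ y‖` are log-convex in `n`, so that they cannot decay
faster than every geometric sequence unless `A y = 0`. -/
theorem apply_eq_zero_of_norm_pow_apply_le {A : X →L[ℝ] X} (hA : ∀ x y, ⟪A x, y⟫ = ⟪x, A y⟫)
    {y : X} (h : ∀ q : ℝ, 0 < q → ∃ C : ℝ, ∀ n : ℕ, ‖(A ^ n) y‖ ≤ C * q ^ n) : A y = 0 := by
  by_contra hAy
  have h1 : 0 < ‖A y‖ := norm_pos_iff.2 hAy
  have h0 : 0 < ‖y‖ := norm_pos_iff.2 fun h => hAy (by rw [h, map_zero])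
  set r := ‖A y‖ / ‖y‖ with hr
  have hrp : 0 < r := div_pos h1 h0
  -- By symmetry and Cauchy–Schwarz the ratios of consecutive norms never decrease, so all are at
  -- least the first one, `r`; positivity is carried along to allow cancellation.
  have hstep : ∀ n, 0 < ‖(A ^ n) y‖ ∧ r * ‖(A ^ n) y‖ ≤ ‖(A ^ (n + 1)) y‖ := by
    intro n
    induction n with
    | zero => simp [h0, hr, h0.ne']
    | succ n ih =>
      have hpos : 0 < ‖(A ^ (n + 1)) y‖ := (mul_pos hrp ih.1).trans_le ih.2
      refine ⟨hpos, ?_⟩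
      have hsq : ‖(A ^ (n + 1)) y‖ * ‖(A ^ (n + 1)) y‖ ≤ ‖(A ^ (n + 2)) y‖ * ‖(A ^ n) y‖ := by
        have e : ⟪(A ^ (n + 2)) y, (A ^ n) y⟫ = ⟪(A ^ (n + 1)) y, (A ^ (n + 1)) y⟫ := by
          rw [pow_succ' A (n + 1), pow_succ' A n]
          simp only [mul_apply_eq_comp]
          rw [hA]
        rw [← real_inner_self_eq_norm_mul_norm, ← e]
        exact real_inner_le_norm _ _
      have : r * ‖(A ^ (n + 1)) y‖ * ‖(A ^ n) y‖ ≤ ‖(A ^ (n + 2)) y‖ * ‖(A ^ n) y‖ := by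
        refine le_trans ?_ hsq
        nlinarith [mul_le_mul_of_nonneg_right ih.2 hpos.le]
      exact le_of_mul_le_mul_right this ih.1
  have hlow : ∀ n, ‖y‖ * r ^ n ≤ ‖(A ^ n) y‖ := by
    intro n
    induction n with
    | zero => simp
    | succ n ih =>
      refine le_trans ?_ (hstep n).2
      rw [pow_succ]
      nlinarith [mul_le_mul_of_nonneg_left ih hrp.le]
  -- The bounds `‖y‖ rⁿ ≤ C (r / 2)ⁿ` would keep `2ⁿ` below `C / ‖y‖`.
  obtain ⟨C, hC⟩ := h (r / 2) (by positivity)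
  obtain ⟨n, hn⟩ := pow_unbounded_of_one_lt (C / ‖y‖) (one_lt_two (α := ℝ))
  have := (hlow n).trans (hC n)
  rw [div_pow r, mul_div_assoc', le_div_iff₀ (by positivity)] at this
  rw [div_lt_iff₀ h0] at hn
  have hrn : 0 < r ^ n := by positivity
  nlinarith [mul_lt_mul_of_pos_right hn hrn]

theorem integrableOn_rlKernel_smul {E : Type*} [NormedAddCommGroup E] [NormedSpace ℝ E]
    {α t : ℝ} (hα : 0 < α) {y : ℝ → E} (hy : ContinuousOn y (Icc 0 t)) :
    IntegrableOn (fun s => rlKernel α (t - s) • y s) (Ioo 0 t) := by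
  rcases le_or_gt t 0 with h | h
  · simp [Ioo_eq_empty_of_le h]
  have h1 : IntegrableOn (fun s => rlKernel α (t - s)) (Ioo 0 t) := by
    have := ((intervalIntegrable_iff_integrableOn_Ioo_of_le h.le).2
      (integrableOn_rlKernel hα t)).comp_sub_left t
    simp only [sub_zero, sub_self] at this
    exact (intervalIntegrable_iff_integrableOn_Ioo_of_le h.le).1 this.symm
  exact h1.smul_continuousOn_of_subset hy measurableSet_Ioo isCompact_Icc Ioo_subset_Icc_self

variable [CompleteSpace X]

theorem ContinuousLinearMap.map_volterra {E F : Type*} [NormedAddCommGroup E] [NormedSpace ℝ E]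
    [NormedAddCommGroup F] [NormedSpace ℝ F] [CompleteSpace E] [CompleteSpace F]
    (B : E →L[ℝ] F) {f : ℝ → ℝ} {g : ℝ → E} {t : ℝ} (ht : 0 ≤ t)
    (h : IntegrableOn (fun s => f (t - s) • g s) (Ioo 0 t)) :
    B (volterra f g t) = volterra f (fun s => B (g s)) t := by
  rw [volterra_eq_setIntegral _ _ ht, volterra_eq_setIntegral _ _ ht,
    ← B.integral_comp_comm h]
  simp only [map_smul]

/-- Uniqueness for the abstract subdiffusion equation `A y + (1 - A) J^α y = 0`. -/
theorem apply_eq_zero_of_volterra {A : X →L[ℝ] X} (hA : ∀ x y, ⟪A x, y⟫ = ⟪x, A y⟫)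
    {α T : ℝ} (hα : 0 < α) {y : ℝ → X} (hy : ContinuousOn y (Icc 0 T))
    (h : ∀ t ∈ Icc 0 T, A (y t) = -((1 - A) (volterra (rlKernel α) y t))) :
    ∀ t ∈ Icc 0 T, A (y t) = 0 := by
  obtain ⟨C, hC⟩ := isCompact_Icc.exists_bound_of_continuousOn hy
  -- Each use of the equation trades one factor `A` for `-(1 - A)` and a convolution with `k_α`,
  -- which gains `l ^ (-α)` against the weight `exp (l t)`.
  have key : ∀ l : ℝ, 0 < l → ∀ n : ℕ, ∀ t ∈ Icc 0 T,
      ‖(A ^ n) (y t)‖ ≤ C * (‖1 - A‖ * l ^ (-α)) ^ n * Real.exp (l * t) := by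
    intro l hl n
    induction n with
    | zero =>
      intro t ht
      have h1 : 1 ≤ Real.exp (l * t) := Real.one_le_exp (mul_nonneg hl.le ht.1)
      have h2 := hC t ht
      simp only [pow_zero, one_apply_eq_self, mul_one]
      exact h2.trans (le_mul_of_one_le_right ((norm_nonneg _).trans h2) h1)
    | succ n ih =>
      intro t ht
      have hC0 : 0 ≤ C := (norm_nonneg _).trans (hC t ht)
      have hint := integrableOn_rlKernel_smul hα (hy.mono (Icc_subset_Icc_right ht.2))
      have e1 : (A ^ (n + 1)) (y t) =
          -((1 - A) (volterra (rlKernel α) (fun s => (A ^ n) (y s)) t)) := by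
        have hc : A ^ n * (1 - A) = (1 - A) * A ^ n := by
          rw [mul_sub, sub_mul, mul_one, one_mul, ← pow_succ, ← pow_succ']
        rw [pow_succ, mul_apply_eq_comp, h t ht, map_neg,
          ← mul_apply_eq_comp, hc, mul_apply_eq_comp,
          (A ^ n).map_volterra ht.1 hint]
      have e2 : ‖volterra (rlKernel α) (fun s => (A ^ n) (y s)) t‖ ≤
          (C * (‖1 - A‖ * l ^ (-α)) ^ n) * (l ^ (-α) * Real.exp (l * t)) := by
        refine le_trans ?_ (mul_le_mul_of_nonneg_left (volterra_rlKernel_exp_le hα hl ht.1)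
          (by positivity))
        rw [volterra_eq_setIntegral _ _ ht.1, volterra_eq_setIntegral _ _ ht.1,
          ← integral_const_mul]
        have hexp : IntegrableOn (fun s => rlKernel α (t - s) • Real.exp (l * s)) (Ioo 0 t) :=
          integrableOn_rlKernel_smul hα (Continuous.continuousOn (by fun_prop))
        refine norm_integral_le_of_norm_le (hexp.const_mul _) ?_
        filter_upwards [ae_restrict_mem measurableSet_Ioo] with s hs
        have hk : 0 ≤ rlKernel α (t - s) := rlKernel_nonneg hα (by linarith [hs.2])
        rw [norm_smul, Real.norm_of_nonneg hk, smul_eq_mul]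
        have := mul_le_mul_of_nonneg_left (ih s ⟨hs.1.le, hs.2.le.trans ht.2⟩) hk
        linarith
      rw [e1, norm_neg]
      refine ((1 - A).le_opNorm _).trans ((mul_le_mul_of_nonneg_left e2 (norm_nonneg _)).trans
        (le_of_eq ?_))
      rw [pow_succ]
      ring
  intro t ht
  refine apply_eq_zero_of_norm_pow_apply_le hA fun q hq => ?_
  have hlim : Tendsto (fun l : ℝ => ‖1 - A‖ * l ^ (-α)) atTop (𝓝 (‖1 - A‖ * 0)) :=
    (tendsto_rpow_neg_atTop hα).const_mul _
  rw [mul_zero] at hlim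
  obtain ⟨l, hl0, hlq⟩ := ((eventually_gt_atTop (0 : ℝ)).and
    (hlim.eventually (gt_mem_nhds hq))).exists
  have hC0 : 0 ≤ C := (norm_nonneg _).trans (hC t ht)
  refine ⟨C * Real.exp (l * t), fun n => (key l hl0 n t ht).trans ?_⟩
  rw [mul_right_comm]
  refine mul_le_mul_of_nonneg_left (pow_le_pow_left₀ ?_ hlq.le n) (by positivity)
  positivity

end Operator
end

noncomputable section

open scoped RealInnerProductSpace

variable {d : ℕ}

/-! ### Test functions and their gradients. -/

section TestFunctions

variable {Ω : Set (EuclideanSpace ℝ (Fin d))} {φ ψ : EuclideanSpace ℝ (Fin d) → ℝ}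

theorem gradient_add_of_differentiable (hφ : Differentiable ℝ φ) (hψ : Differentiable ℝ ψ) :
    gradient (φ + ψ) = gradient φ + gradient ψ := by
  ext1 x
  simp only [gradient, Pi.add_apply]
  rw [fderiv_add (hφ x) (hψ x), map_add]

theorem gradient_smul_of_differentiable (hφ : Differentiable ℝ φ) (c : ℝ) :
    gradient (c • φ) = c • gradient φ := by
  ext1 x
  simp only [gradient, Pi.smul_apply]
  rw [fderiv_const_smul (hφ x)]
  simp

theorem gradient_zero_fun : gradient (0 : EuclideanSpace ℝ (Fin d) → ℝ) = 0 := by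
  ext1 x
  simp [gradient]

namespace IsTestFunction

theorem differentiable (hφ : IsTestFunction Ω φ) : Differentiable ℝ φ :=
  hφ.1.differentiable (by simp)

theorem continuous_gradient (hφ : IsTestFunction Ω φ) : Continuous (gradient φ) :=
  (LinearIsometryEquiv.continuous _).comp (hφ.1.continuous_fderiv (by simp))

theorem hasCompactSupport_gradient (hφ : IsTestFunction Ω φ) : HasCompactSupport (gradient φ) :=
  (hφ.2.1.fderiv ℝ).comp_left (map_zero _)

theorem memLp (hφ : IsTestFunction Ω φ) : MemLp φ 2 (volume.restrict Ω) :=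
  hφ.1.continuous.memLp_of_hasCompactSupport hφ.2.1

theorem memLp_gradient (hφ : IsTestFunction Ω φ) : MemLp (gradient φ) 2 (volume.restrict Ω) :=
  hφ.continuous_gradient.memLp_of_hasCompactSupport hφ.hasCompactSupport_gradient

theorem zero (Ω : Set (EuclideanSpace ℝ (Fin d))) : IsTestFunction Ω 0 :=
  ⟨contDiff_const, HasCompactSupport.zero, by simp [tsupport]⟩

theorem add (hφ : IsTestFunction Ω φ) (hψ : IsTestFunction Ω ψ) : IsTestFunction Ω (φ + ψ) :=
  ⟨hφ.1.add hψ.1, hφ.2.1.add hψ.2.1, (tsupport_add φ ψ).trans (union_subset hφ.2.2 hψ.2.2)⟩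

theorem smul (hφ : IsTestFunction Ω φ) (c : ℝ) : IsTestFunction Ω (c • φ) :=
  ⟨hφ.1.const_smul c, hφ.2.1.smul_left (f := fun _ => c),
    (tsupport_smul_subset_right (fun _ => c) φ).trans hφ.2.2⟩

end IsTestFunction

end TestFunctions

/-! ### The Hilbert space `H₀¹(Ω)` and the weak formulation in it. -/

section Space

variable (Ω : Set (EuclideanSpace ℝ (Fin d)))

/-- The Hilbert space `L²(Ω) × L²(Ω; ℝᵈ)`. -/
abbrev L2Pair : Type :=
  WithLp 2 (Lp ℝ 2 (volume.restrict Ω) × Lp (EuclideanSpace ℝ (Fin d)) 2 (volume.restrict Ω))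

/-- The pairs `(φ, ∇φ)` for `φ ∈ C_c^∞(Ω)`. -/
def testPairs : Submodule ℝ (L2Pair Ω) where
  carrier := {p | ∃ φ : EuclideanSpace ℝ (Fin d) → ℝ, IsTestFunction Ω φ ∧
    p.fst =ᵐ[volume.restrict Ω] φ ∧ p.snd =ᵐ[volume.restrict Ω] gradient φ}
  zero_mem' := ⟨0, IsTestFunction.zero Ω, Lp.coeFn_zero _ _ _, by
    rw [gradient_zero_fun]; exact Lp.coeFn_zero _ _ _⟩
  add_mem' := by
    rintro p q ⟨φ, hφ, hp1, hp2⟩ ⟨ψ, hψ, hq1, hq2⟩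
    refine ⟨φ + ψ, hφ.add hψ, ?_, ?_⟩
    · exact (Lp.coeFn_add _ _).trans (hp1.add hq1)
    · rw [gradient_add_of_differentiable hφ.differentiable hψ.differentiable]
      exact (Lp.coeFn_add _ _).trans (hp2.add hq2)
  smul_mem' := by
    rintro c p ⟨φ, hφ, hp1, hp2⟩
    refine ⟨c • φ, hφ.smul c, ?_, ?_⟩
    · exact (Lp.coeFn_smul _ _).trans (hp1.const_smul c)
    · rw [gradient_smul_of_differentiable hφ.differentiable]
      exact (Lp.coeFn_smul _ _).trans (hp2.const_smul c)

/-- `H₀¹(Ω)` as a closed subspace of `L²(Ω) × L²(Ω; ℝᵈ)`. -/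
abbrev H10Submodule : Submodule ℝ (L2Pair Ω) := (testPairs Ω).topologicalClosure

theorem toLp_mem_H10Submodule_iff
    (p : Lp ℝ 2 (volume.restrict Ω) × Lp (EuclideanSpace ℝ (Fin d)) 2 (volume.restrict Ω)) :
    WithLp.toLp 2 p ∈ H10Submodule Ω ↔ p ∈ H10 Ω := by
  constructor
  · intro h
    exact map_mem_closure (WithLp.prod_continuous_ofLp 2 _ _) h fun q hq => hq
  · intro h
    exact map_mem_closure (WithLp.prod_continuous_toLp 2 _ _) h fun q hq => hq

/-- `H₀¹(Ω)` as a Hilbert space. -/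
def H10Space : Type := H10Submodule Ω

namespace H10Space

instance : NormedAddCommGroup (H10Space Ω) := inferInstanceAs (NormedAddCommGroup (H10Submodule Ω))

instance : InnerProductSpace ℝ (H10Space Ω) :=
  inferInstanceAs (InnerProductSpace ℝ (H10Submodule Ω))

instance : CompleteSpace (H10Space Ω) := inferInstanceAs (CompleteSpace (H10Submodule Ω))

/-- The inclusion of `H₀¹(Ω)` into `L²(Ω) × L²(Ω; ℝᵈ)`. -/
def incl : H10Space Ω →L[ℝ] L2Pair Ω := (H10Submodule Ω).subtypeL

/-- The orthogonal projection of `L²(Ω) × L²(Ω; ℝᵈ)` onto `H₀¹(Ω)`. -/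
def proj : L2Pair Ω →L[ℝ] H10Space Ω := (H10Submodule Ω).orthogonalProjectionOnto

theorem incl_mem (x : H10Space Ω) : incl Ω x ∈ H10Submodule Ω :=
  Subtype.property (p := (· ∈ H10Submodule Ω)) x

theorem incl_proj {p : L2Pair Ω} (hp : p ∈ H10Submodule Ω) : incl Ω (proj Ω p) = p :=
  Submodule.starProjection_eq_self_iff.2 hp

/-- The function component of an element of `H₀¹(Ω)`. -/
def val : H10Space Ω →L[ℝ] Lp ℝ 2 (volume.restrict Ω) :=
  (WithLp.fstL 2 ℝ _ _).comp (incl Ω)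

/-- The gradient component of an element of `H₀¹(Ω)`. -/
def grad : H10Space Ω →L[ℝ] Lp (EuclideanSpace ℝ (Fin d)) 2 (volume.restrict Ω) :=
  (WithLp.sndL 2 ℝ _ _).comp (incl Ω)

theorem inner_eq_inner_incl (x y : H10Space Ω) : ⟪x, y⟫ = ⟪incl Ω x, incl Ω y⟫ := rfl

end H10Space

variable {Ω}

theorem H10Space.inner_eq (x y : H10Space Ω) :
    ⟪x, y⟫ = ⟪val Ω x, val Ω y⟫ + ⟪grad Ω x, grad Ω y⟫ := by
  rw [inner_eq_inner_incl]
  exact WithLp.prod_inner_apply _ _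

variable {φ : EuclideanSpace ℝ (Fin d) → ℝ}

/-- A test function as an element of `H₀¹(Ω)`. -/
def IsTestFunction.toH10 (hφ : IsTestFunction Ω φ) : H10Space Ω :=
  ⟨WithLp.toLp 2 (hφ.memLp.toLp φ, hφ.memLp_gradient.toLp (gradient φ)),
    Submodule.le_topologicalClosure _ ⟨φ, hφ, hφ.memLp.coeFn_toLp, hφ.memLp_gradient.coeFn_toLp⟩⟩

theorem IsTestFunction.inner_val (hφ : IsTestFunction Ω φ) (f : Lp ℝ 2 (volume.restrict Ω)) :
    ⟪f, H10Space.val Ω hφ.toH10⟫ = ∫ x in Ω, f x * φ x := by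
  rw [L2.inner_def]
  refine integral_congr_ae ?_
  filter_upwards [hφ.memLp.coeFn_toLp] with x hx
  change ⟪f x, (hφ.memLp.toLp φ : EuclideanSpace ℝ (Fin d) → ℝ) x⟫ = _
  rw [hx]
  simp [mul_comm]

theorem IsTestFunction.inner_grad (hφ : IsTestFunction Ω φ)
    (f : Lp (EuclideanSpace ℝ (Fin d)) 2 (volume.restrict Ω)) :
    ⟪f, H10Space.grad Ω hφ.toH10⟫ = ∫ x in Ω, ⟪f x, gradient φ x⟫ := by
  rw [L2.inner_def]
  refine integral_congr_ae ?_
  filter_upwards [hφ.memLp_gradient.coeFn_toLp] with x hx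
  change ⟪f x, (hφ.memLp_gradient.toLp (gradient φ) : EuclideanSpace ℝ (Fin d) → _) x⟫ = _
  rw [hx]

theorem H10Space.eq_zero_of_inner_test {x : H10Space Ω}
    (h : ∀ φ (hφ : IsTestFunction Ω φ), ⟪x, hφ.toH10⟫ = 0) : x = 0 := by
  have h1 : ∀ p ∈ testPairs Ω, ⟪incl Ω x, p⟫ = 0 := by
    rintro p ⟨φ, hφ, hp1, hp2⟩
    have : p = incl Ω hφ.toH10 := by
      refine WithLp.ofLp_injective 2 (Prod.ext ?_ ?_)
      · exact Lp.ext (hp1.trans hφ.memLp.coeFn_toLp.symm)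
      · exact Lp.ext (hp2.trans hφ.memLp_gradient.coeFn_toLp.symm)
    rw [this, ← inner_eq_inner_incl]
    exact h φ hφ
  have h2 : (H10Submodule Ω : Set (L2Pair Ω)) ⊆ {p | ⟪incl Ω x, p⟫ = 0} :=
    closure_minimal h1 (isClosed_eq (by fun_prop) continuous_const)
  exact inner_self_eq_zero.1 ((inner_eq_inner_incl Ω x x).trans (h2 (incl_mem Ω x)))

variable {α T : ℝ} {ρ : ℝ → ℝ} {g u₀ : EuclideanSpace ℝ (Fin d) → ℝ}
  {u : EuclideanSpace ℝ (Fin d) → ℝ → ℝ}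

/-- Solutions expressed through functions with values in the Hilbert space `H₀¹(Ω)`. -/
theorem isSolution_iff : IsSolution α T Ω ρ g u₀ u ↔
    ContinuousOn (fun p : EuclideanSpace ℝ (Fin d) × ℝ => u p.1 p.2) (Ω ×ˢ Icc 0 T) ∧
    (∀ x ∈ Ω, u x 0 = u₀ x) ∧
    ∃ w : ℝ → H10Space Ω, IntegrableOn w (Ioo 0 T) ∧
      (∀ᵐ t ∂volume.restrict (Ioo 0 T),
        H10Space.val Ω (w t) =ᵐ[volume.restrict Ω] fun x => u x t) ∧
      ∀ φ (hφ : IsTestFunction Ω φ), CaputoAdmissible T (fun t => ∫ x in Ω, u x t * φ x) ∧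
        ∀ᵐ t ∂volume.restrict (Ioo 0 T), caputo α (fun s => ∫ x in Ω, u x s * φ x) t +
          ⟪H10Space.grad Ω (w t), H10Space.grad Ω hφ.toH10⟫ = ρ t * ∫ x in Ω, g x * φ x := by
  unfold IsSolution
  refine and_congr_right fun _ => and_congr_right fun _ => ⟨?_, ?_⟩
  · rintro ⟨U, hUi, hU, hφU⟩
    set W : ℝ → L2Pair Ω := fun t => WithLp.toLp 2 (U t) with hW
    have hWi : IntegrableOn W (Ioo 0 T) :=
      (WithLp.prodContinuousLinearEquiv 2 ℝ (Lp ℝ 2 (volume.restrict Ω))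
        (Lp (EuclideanSpace ℝ (Fin d)) 2 (volume.restrict Ω))).symm.toContinuousLinearMap
        |>.integrable_comp hUi
    have hPW : ∀ t, U t ∈ H10 Ω → H10Space.incl Ω (H10Space.proj Ω (W t)) = W t := fun t ht =>
      H10Space.incl_proj Ω ((toLp_mem_H10Submodule_iff Ω _).2 ht)
    -- Membership in `H₀¹` is known only for almost every `t`. Projecting gives an integrable
    -- function with values in `H₀¹` at every `t`, unchanged at the good times.
    refine ⟨fun t => H10Space.proj Ω (W t), (H10Space.proj Ω).integrable_comp hWi, ?_,
      fun φ hφ => ⟨(hφU φ hφ).1, ?_⟩⟩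
    · filter_upwards [hU] with t ht
      have : H10Space.val Ω (H10Space.proj Ω (W t)) = (U t).1 :=
        congrArg WithLp.fst (hPW t ht.1)
      rw [this]
      exact ht.2
    · filter_upwards [hU, (hφU φ hφ).2] with t ht ht2
      have : H10Space.grad Ω (H10Space.proj Ω (W t)) = (U t).2 :=
        congrArg WithLp.snd (hPW t ht.1)
      rw [this, hφ.inner_grad]
      exact ht2
  · rintro ⟨w, hwi, hw, hφw⟩
    refine ⟨fun t => WithLp.ofLp (H10Space.incl Ω (w t)), ?_, ?_, fun φ hφ => ⟨(hφw φ hφ).1, ?_⟩⟩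
    · exact ((WithLp.prodContinuousLinearEquiv 2 ℝ _ _).toContinuousLinearMap.comp
        (H10Space.incl Ω)).integrable_comp hwi
    · filter_upwards [hw] with t ht
      exact ⟨(toLp_mem_H10Submodule_iff Ω _).1 (H10Space.incl_mem Ω (w t)), ht⟩
    · filter_upwards [(hφw φ hφ).2] with t ht
      rw [hφ.inner_grad] at ht
      exact ht

end Space
end

/-! ### Testing in space, and time convolutions of continuous functions. -/

noncomputable section

open scoped RealInnerProductSpace

variable {d : ℕ} {Ω : Set (EuclideanSpace ℝ (Fin d))} {φ : EuclideanSpace ℝ (Fin d) → ℝ}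

/-- The preimages of `Ω` and of the complement of `tsupport φ` form an open cover, and the product
vanishes on the latter. -/
theorem IsTestFunction.continuous_mul_comp (hφ : IsTestFunction Ω φ) (hΩ : IsOpen Ω)
    {Y : Type*} [TopologicalSpace Y] {π : Y → EuclideanSpace ℝ (Fin d)} (hπ : Continuous π)
    {c : Y → ℝ} (hc : ContinuousOn c (π ⁻¹' Ω)) : Continuous fun p => c p * φ (π p) := by
  refine continuous_iff_continuousAt.2 fun p => ?_
  by_cases hp : π p ∈ Ω
  · exact (hc.continuousAt ((hΩ.preimage hπ).mem_nhds hp)).mul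
      (hφ.1.continuous.comp hπ).continuousAt
  · have hp' : p ∈ (π ⁻¹' tsupport φ)ᶜ := fun h => hp (hφ.2.2 h)
    refine (continuousAt_const (y := (0 : ℝ))).congr ?_
    filter_upwards [(((isClosed_tsupport φ).preimage hπ).isOpen_compl).mem_nhds hp'] with q hq
    rw [image_eq_zero_of_notMem_tsupport hq, mul_zero]

theorem IsTestFunction.integrable_mul (hφ : IsTestFunction Ω φ) (hΩ : IsOpen Ω)
    {c : EuclideanSpace ℝ (Fin d) → ℝ} (hc : ContinuousOn c Ω) :
    Integrable (fun x => c x * φ x) (volume.restrict Ω) :=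
  ((hφ.continuous_mul_comp hΩ continuous_id hc).integrable_of_hasCompactSupport
    (hφ.2.1.mul_left (f := c))).restrict

theorem ae_eq_zero_of_integral_test (hΩ : IsOpen Ω) {f : EuclideanSpace ℝ (Fin d) → ℝ}
    (hf : LocallyIntegrableOn f Ω (volume.restrict Ω))
    (h : ∀ φ, IsTestFunction Ω φ → ∫ x in Ω, f x * φ x = 0) : f =ᵐ[volume.restrict Ω] 0 := by
  have h1 := hΩ.ae_eq_zero_of_integral_contDiff_smul_eq_zero hf fun ψ h1 h2 h3 => by
    rw [← h ψ ⟨h1, h2, h3⟩]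
    simp only [smul_eq_mul, mul_comm]
  filter_upwards [h1, ae_restrict_mem hΩ.measurableSet] with x hx hxΩ using hx hxΩ

theorem Lp.ae_eq_of_integral_test (hΩ : IsOpen Ω) (f : Lp ℝ 2 (volume.restrict Ω))
    {c : EuclideanSpace ℝ (Fin d) → ℝ} (hc : ContinuousOn c Ω)
    (h : ∀ φ, IsTestFunction Ω φ → ∫ x in Ω, f x * φ x = ∫ x in Ω, c x * φ x) :
    f =ᵐ[volume.restrict Ω] c := by
  have hf : LocallyIntegrable f (volume.restrict Ω) := (Lp.memLp f).locallyIntegrable (by norm_num)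
  have := ae_eq_zero_of_integral_test hΩ (f := fun x => f x - c x)
    (hf.locallyIntegrableOn Ω |>.sub (hc.locallyIntegrableOn hΩ.measurableSet)) fun φ hφ => by
      simp only [sub_mul]
      have hi : Integrable (fun x => f x * φ x) (volume.restrict Ω) :=
        hf.integrable_smul_right_of_hasCompactSupport hφ.1.continuous hφ.2.1
      rw [integral_sub hi (hφ.integrable_mul hΩ hc), h φ hφ, sub_self]
  filter_upwards [this] with x hx
  exact sub_eq_zero.1 hx

theorem eqOn_of_integral_test (hΩ : IsOpen Ω) {c c' : EuclideanSpace ℝ (Fin d) → ℝ}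
    (hc : ContinuousOn c Ω) (hc' : ContinuousOn c' Ω)
    (h : ∀ φ, IsTestFunction Ω φ → ∫ x in Ω, c x * φ x = ∫ x in Ω, c' x * φ x) :
    EqOn c c' Ω := by
  have := ae_eq_zero_of_integral_test hΩ (f := fun x => c x - c' x)
    ((hc.sub hc').locallyIntegrableOn hΩ.measurableSet) fun φ hφ => by
      simp only [sub_mul]
      rw [integral_sub (hφ.integrable_mul hΩ hc) (hφ.integrable_mul hΩ hc'), h φ hφ, sub_self]
  refine Measure.eqOn_open_of_ae_eq (μ := volume) ?_ hΩ hc hc'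
  filter_upwards [this] with x hx
  exact sub_eq_zero.1 hx

section Joint

variable {T : ℝ} {u : EuclideanSpace ℝ (Fin d) → ℝ → ℝ} {f : ℝ → ℝ}

theorem continuousOn_slice_left
    (hu : ContinuousOn (fun p : EuclideanSpace ℝ (Fin d) × ℝ => u p.1 p.2) (Ω ×ˢ Icc 0 T))
    {t : ℝ} (ht : t ∈ Icc 0 T) : ContinuousOn (fun x => u x t) Ω :=
  hu.comp (f := fun x => (x, t)) (by fun_prop) fun _ hx => ⟨hx, ht⟩

theorem continuousOn_slice_right
    (hu : ContinuousOn (fun p : EuclideanSpace ℝ (Fin d) × ℝ => u p.1 p.2) (Ω ×ˢ Icc 0 T))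
    {x : EuclideanSpace ℝ (Fin d)} (hx : x ∈ Ω) : ContinuousOn (u x) (Icc 0 T) :=
  hu.comp (f := fun t => (x, t)) (by fun_prop) fun _ ht => ⟨hx, ht⟩

theorem continuousOn_uncurry_volterra (hΩ : IsOpen Ω) (hT : 0 ≤ T)
    (hu : ContinuousOn (fun p : EuclideanSpace ℝ (Fin d) × ℝ => u p.1 p.2) (Ω ×ˢ Icc 0 T))
    (hf : ContinuousOn f (Icc 0 T)) :
    ContinuousOn (fun p : EuclideanSpace ℝ (Fin d) × ℝ => volterra f (u p.1) p.2)
      (Ω ×ˢ Icc 0 T) := by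
  have : LocallyCompactSpace Ω := hΩ.locallyCompactSpace
  have hF : Continuous fun t => f (projIcc 0 T hT t) :=
    (continuousOn_iff_continuous_domRestrict.1 hf).comp continuous_projIcc
  have hU : Continuous fun q : (Ω × Icc 0 T) × ℝ => u q.1.1 (projIcc 0 T hT q.2) :=
    hu.comp_continuous (f := fun q : (Ω × Icc 0 T) × ℝ =>
      ((q.1.1 : EuclideanSpace ℝ (Fin d)), (projIcc 0 T hT q.2 : ℝ)))
      (by fun_prop) fun q => ⟨q.1.1.2, (projIcc 0 T hT q.2).2⟩
  have key : Continuous fun q : Ω × Icc 0 T => ∫ s in (0 : ℝ)..q.2,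
      f (projIcc 0 T hT (q.2 - s)) • u q.1 (projIcc 0 T hT s) := by
    refine intervalIntegral.continuous_parametric_intervalIntegral_of_continuous
      (f := fun (q : Ω × Icc 0 T) (s : ℝ) =>
        f (projIcc 0 T hT (q.2 - s)) • u q.1 (projIcc 0 T hT s)) ?_ (by fun_prop)
    refine Continuous.mul ?_ hU
    exact hF.comp (by fun_prop : Continuous fun q : (Ω × Icc 0 T) × ℝ => ((q.1.2 : ℝ) - q.2))
  rw [continuousOn_iff_continuous_domRestrict]
  have hc : Continuous fun p : ↥(Ω ×ˢ Icc (0 : ℝ) T) =>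
      ((⟨p.1.1, p.2.1⟩, ⟨p.1.2, p.2.2⟩) : Ω × Icc (0 : ℝ) T) := by fun_prop
  refine (key.comp hc).congr fun p => ?_
  refine intervalIntegral.integral_congr fun s hs => ?_
  rw [uIcc_of_le p.2.2.1] at hs
  have h1 : s ∈ Icc 0 T := ⟨hs.1, hs.2.trans p.2.2.2⟩
  have h2 : p.1.2 - s ∈ Icc 0 T := ⟨by linarith [hs.2], by linarith [hs.1, p.2.2.2]⟩
  simp [projIcc_of_mem hT h1, projIcc_of_mem hT h2]

theorem IsTestFunction.integral_volterra_mul (hφ : IsTestFunction Ω φ) (hΩ : IsOpen Ω)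
    (hu : ContinuousOn (fun p : EuclideanSpace ℝ (Fin d) × ℝ => u p.1 p.2) (Ω ×ˢ Icc 0 T))
    (hf : ContinuousOn f (Icc 0 T)) {t : ℝ} (ht : t ∈ Icc 0 T) :
    ∫ x in Ω, volterra f (u x) t * φ x = volterra f (fun s => ∫ x in Ω, u x s * φ x) t := by
  have hT : 0 ≤ T := ht.1.trans ht.2
  set H : EuclideanSpace ℝ (Fin d) → ℝ → ℝ := fun x s =>
    f (projIcc 0 T hT (t - s)) * (u x (projIcc 0 T hT s) * φ x) with hH
  have hF : Continuous fun t => f (projIcc 0 T hT t) :=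
    (continuousOn_iff_continuous_domRestrict.1 hf).comp continuous_projIcc
  have hHc : Continuous (Function.uncurry H) := by
    refine Continuous.mul (hF.comp (by fun_prop :
      Continuous fun p : EuclideanSpace ℝ (Fin d) × ℝ => t - p.2)) ?_
    refine hφ.continuous_mul_comp hΩ continuous_fst
      (c := fun p : EuclideanSpace ℝ (Fin d) × ℝ => u p.1 (projIcc 0 T hT p.2)) ?_
    exact hu.comp (f := fun p : EuclideanSpace ℝ (Fin d) × ℝ =>
      (p.1, (projIcc 0 T hT p.2 : ℝ))) (by fun_prop) fun p hp => ⟨hp, (projIcc 0 T hT p.2).2⟩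
  have hHi : Integrable (Function.uncurry H)
      ((volume.restrict Ω).prod (volume.restrict (Ioo 0 t))) := by
    -- Fubini needs only integrability on the compact set `tsupport φ ×ˢ Icc 0 t`, outside which the
    -- continuous integrand vanishes on the domain.
    rw [Measure.prod_restrict]
    have h1 : IntegrableOn (Function.uncurry H) (tsupport φ ×ˢ Icc 0 t)
        ((volume : Measure (EuclideanSpace ℝ (Fin d))).prod volume) :=
      hHc.continuousOn.integrableOn_compact (IsCompact.prod hφ.2.1 isCompact_Icc)
    refine IntegrableOn.of_forall_sdiff_eq_zero h1 (hΩ.measurableSet.prod measurableSet_Ioo) ?_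
    rintro ⟨x, s⟩ ⟨hx, hx'⟩
    have : x ∉ tsupport φ := fun h => hx' ⟨h, Ioo_subset_Icc_self hx.2⟩
    simp [hH, image_eq_zero_of_notMem_tsupport this]
  have hHeq : ∀ x, ∀ s ∈ Ioo 0 t, H x s = f (t - s) * (u x s * φ x) := fun x s hs => by
    have h1 : s ∈ Icc 0 T := ⟨hs.1.le, hs.2.le.trans ht.2⟩
    have h2 : t - s ∈ Icc 0 T := ⟨by linarith [hs.2], by linarith [hs.1, ht.2]⟩
    simp [hH, projIcc_of_mem hT h1, projIcc_of_mem hT h2]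
  have e1 : ∀ x, volterra f (u x) t * φ x = ∫ s in Ioo 0 t, H x s := fun x => by
    rw [volterra_eq_setIntegral _ _ ht.1, ← integral_mul_const]
    refine setIntegral_congr_fun measurableSet_Ioo fun s hs => ?_
    rw [hHeq x s hs, smul_eq_mul, mul_assoc]
  simp only [e1]
  rw [integral_integral_swap hHi, volterra_eq_setIntegral _ _ ht.1]
  refine setIntegral_congr_fun measurableSet_Ioo fun s hs => ?_
  rw [smul_eq_mul, ← integral_const_mul]
  exact integral_congr_ae (Eventually.of_forall fun x => hHeq x s hs)

end Joint

theorem integrableOn_volterra_integrand {E : Type*} [NormedAddCommGroup E] [NormedSpace ℝ E]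
    {T : ℝ} {f : ℝ → ℝ} {w : ℝ → E} (hf : ContinuousOn f (Icc 0 T))
    (hw : IntegrableOn w (Ioo 0 T)) {t : ℝ} (ht : t ∈ Icc 0 T) :
    IntegrableOn (fun s => f (t - s) • w s) (Ioo 0 t) :=
  (hw.mono_set (Ioo_subset_Ioo_right ht.2)).continuousOn_smul_of_subset (K := Icc 0 t)
    (hf.comp (by fun_prop) fun s hs => ⟨by linarith [hs.2], by linarith [hs.1, ht.2]⟩)
    isCompact_Icc measurableSet_Ioo Ioo_subset_Icc_self

theorem inner_volterra {X Y : Type*} [NormedAddCommGroup X] [NormedSpace ℝ X]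
    [CompleteSpace X] [NormedAddCommGroup Y] [InnerProductSpace ℝ Y]
    (B : X →L[ℝ] Y) (z : Y) {f : ℝ → ℝ} {w : ℝ → X} {t : ℝ} (ht : 0 ≤ t)
    (h : IntegrableOn (fun s => f (t - s) • w s) (Ioo 0 t)) :
    ⟪B (volterra f w t), z⟫ = volterra f (fun s => ⟪B (w s), z⟫) t := by
  have := ((innerSL ℝ z).comp B).map_volterra ht h
  simpa [real_inner_comm] using this

/-! ### Existence by Duhamel's principle, and uniqueness. -/

section Solutions

variable {α T : ℝ} {ρ ρ₁ ρ₂ : ℝ → ℝ} {g u₀ : EuclideanSpace ℝ (Fin d) → ℝ}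
  {u u' v : EuclideanSpace ℝ (Fin d) → ℝ → ℝ}

theorem IsSolution.congr_source (hu : IsSolution α T Ω ρ g u₀ u)
    (h : ∀ t ∈ Ioo 0 T, ρ t = ρ₁ t) : IsSolution α T Ω ρ₁ g u₀ u := by
  obtain ⟨h1, h2, U, hU, hU', hφ⟩ := hu
  refine ⟨h1, h2, U, hU, hU', fun φ hφt => ⟨(hφ φ hφt).1, ?_⟩⟩
  filter_upwards [(hφ φ hφt).2, ae_restrict_mem measurableSet_Ioo] with t ht ht'
  rw [ht, h t ht']

/-- Duhamel's principle: the solution of the inhomogeneous problem with source `ρ(t) g(x)` is a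
Volterra convolution in time of the homogeneous solution with initial value `g`. -/
theorem IsSolution.duhamel (hΩ : IsOpen Ω) (hT : 0 ≤ T) (hα0 : 0 < α) (hα1 : α < 1)
    (hv : IsSolution α T Ω 0 0 g v) (hρ : IsFlatSource T ρ ρ₁ ρ₂) :
    IsSolution α T Ω ρ g 0 (fun x => volterra (volterra (rlKernel α) ρ₁) (v x)) := by
  obtain ⟨hvc, hv0, w, hwi, hw, hφw⟩ := isSolution_iff.1 hv
  set θ := volterra (rlKernel α) ρ₁ with hθdef
  have hθ : ContinuousOn θ (Icc 0 T) :=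
    IsFlatSource.continuousOn_volterra_rlKernel hT hα0 hρ.continuousOn_one
  have hcont := continuousOn_uncurry_volterra hΩ hT hvc hθ
  have hwint : ∀ t ∈ Icc 0 T, IntegrableOn (fun s => θ (t - s) • w s) (Ioo 0 t) :=
    fun t ht => integrableOn_volterra_integrand hθ hwi ht
  refine isSolution_iff.2 ⟨hcont, fun x _ => volterra_at_zero _ _, volterra θ w, ?_, ?_, ?_⟩
  · exact (continuousOn_volterra hT hθ hwi).integrableOn_Icc.mono_set Ioo_subset_Icc_self
  · filter_upwards [ae_restrict_mem measurableSet_Ioo] with t ht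
    have ht' : t ∈ Icc 0 T := Ioo_subset_Icc_self ht
    -- The left side is a Bochner integral of `L²` classes, the right side a pointwise integral for
    -- each `x`; testing compares them.
    refine Lp.ae_eq_of_integral_test hΩ _ (continuousOn_slice_left hcont ht') fun φ hφ => ?_
    rw [← hφ.inner_val, inner_volterra _ _ ht'.1 (hwint t ht'),
      hφ.integral_volterra_mul hΩ hvc hθ ht']
    refine volterra_congr ht'.1 (fun _ _ => rfl) ?_
    filter_upwards [ae_restrict_Ioo_mono ht'.2 hw] with s hs
    rw [hφ.inner_val]
    refine integral_congr_ae ?_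
    filter_upwards [hs] with x hx
    rw [hx]
  · intro φ hφ
    obtain ⟨hG, hGeq⟩ := hφw φ hφ
    have hF : ∀ t ∈ Icc 0 T, volterra θ (fun s => ∫ x in Ω, v x s * φ x) t =
        ∫ x in Ω, volterra θ (v x) t * φ x :=
      fun t ht => (hφ.integral_volterra_mul hΩ hvc hθ ht).symm
    refine ⟨(hρ.caputoAdmissible hT hα0 hG.1).congr hF, ?_⟩
    filter_upwards [ae_restrict_mem measurableSet_Ioo] with t ht
    have ht' : t ∈ Icc 0 T := Ioo_subset_Icc_self ht
    rw [← caputo_congr (fun t ht => hF t (Ioo_subset_Icc_self ht)) ht',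
      inner_volterra _ _ ht'.1 (hwint t ht'),
      hρ.caputo_volterra_add hα0 hα1 hG (hGeq.mono fun s hs => by simpa using hs) ht']
    congr 1
    exact setIntegral_congr_fun hΩ.measurableSet fun x hx => by simp only [hv0 x hx]

/-- Solutions of the initial-boundary value problem are unique. -/
theorem IsSolution.unique (hΩ : IsOpen Ω) (hT : 0 < T) (hα0 : 0 < α) (hα1 : α < 1)
    (hu : IsSolution α T Ω ρ g u₀ u) (hu' : IsSolution α T Ω ρ g u₀ u') :
    ∀ x ∈ Ω, ∀ t ∈ Icc 0 T, u x t = u' x t := by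
  obtain ⟨huc, hu0, w, hwi, hw, hφw⟩ := isSolution_iff.1 hu
  obtain ⟨huc', hu0', w', hwi', hw', hφw'⟩ := isSolution_iff.1 hu'
  set ι := H10Space.val Ω
  set κ := H10Space.grad Ω
  set z : ℝ → H10Space Ω := fun s => w s - w' s with hz
  have hzi : IntegrableOn z (Ioo 0 T) := hwi.sub hwi'
  -- The difference `z` is only `L¹` in time; its primitive is continuous, hence bounded, as the
  -- abstract lemma requires.
  set y : ℝ → H10Space Ω := fun t => ∫ s in (0 : ℝ)..t, z s with hy
  have hyc : ContinuousOn y (Icc 0 T) := continuousOn_integral_of_integrableOn hT.le hzi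
  set F : (EuclideanSpace ℝ (Fin d) → ℝ) → ℝ → ℝ := fun φ t =>
    (∫ x in Ω, u x t * φ x) - ∫ x in Ω, u' x t * φ x with hF
  have hinner : ∀ {Y : Type} [NormedAddCommGroup Y] [InnerProductSpace ℝ Y]
      (B : H10Space Ω →L[ℝ] Y) (p : Y), ∀ t ∈ Icc 0 T,
      ⟪B (y t), p⟫ = ∫ s in (0 : ℝ)..t, ⟪B (z s), p⟫ := by
    intro Y _ _ B p t ht
    have h1 := inner_volterra B p (f := fun _ => 1) (w := z) ht.1
      (integrableOn_volterra_integrand continuousOn_const hzi ht)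
    rwa [volterra_one, volterra_one] at h1
  have hFz : ∀ φ (hφ : IsTestFunction Ω φ), ∀ᵐ t ∂volume.restrict (Ioo 0 T),
      ⟪ι (z t), ι hφ.toH10⟫ = F φ t := by
    intro φ hφ
    filter_upwards [hw, hw'] with t h1 h2
    rw [hz, map_sub, inner_sub_left, hφ.inner_val, hφ.inner_val]
    congr 1
    · exact integral_congr_ae (by filter_upwards [h1] with x hx; rw [hx])
    · exact integral_congr_ae (by filter_upwards [h2] with x hx; rw [hx])
  have hval : ∀ φ (hφ : IsTestFunction Ω φ), ∀ t ∈ Icc 0 T,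
      ⟪ι (y t), ι hφ.toH10⟫ = ∫ s in (0 : ℝ)..t, F φ s := by
    intro φ hφ t ht
    rw [hinner ι _ t ht, ← volterra_one, ← volterra_one]
    exact volterra_congr ht.1 (fun _ _ => rfl) (ae_restrict_Ioo_mono ht.2 (hFz φ hφ))
  have hadm : ∀ φ, IsTestFunction Ω φ → CaputoAdmissible T (F φ) := fun φ hφ =>
    (hφw φ hφ).1.sub (hφw' φ hφ).1
  have heq : ∀ φ (hφ : IsTestFunction Ω φ), ∀ᵐ t ∂volume.restrict (Ioo 0 T),
      caputo α (F φ) t + ⟪κ (z t), κ hφ.toH10⟫ = 0 := by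
    intro φ hφ
    filter_upwards [caputo_sub_ae hα1 (hφw φ hφ).1 (hφw' φ hφ).1, (hφw φ hφ).2, (hφw' φ hφ).2]
      with t h1 h2 h3
    rw [hF, h1, hz, map_sub, inner_sub_left]
    linarith
  have hvolt : ∀ φ (hφ : IsTestFunction Ω φ), ∀ t ∈ Icc 0 T,
      ⟪ι (y t), ι hφ.toH10⟫ = -⟪κ (volterra (rlKernel α) y t), κ hφ.toH10⟫ := by
    intro φ hφ t ht
    rw [hval φ hφ t ht, integral_eq_neg_volterra hα0 hα1 (hadm φ hφ) ?_ (heq φ hφ) ht,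
      inner_volterra κ _ ht.1 (integrableOn_rlKernel_smul hα0
        (hyc.mono (Icc_subset_Icc_right ht.2)))]
    · congr 1
      exact volterra_congr' ht.1 (fun _ _ => rfl)
        fun s hs => (hinner κ _ s ⟨hs.1.le, hs.2.le.trans ht.2⟩).symm
    · rw [hF, sub_eq_zero]
      exact setIntegral_congr_fun hΩ.measurableSet fun x hx => by
        simp only [hu0 x hx, hu0' x hx]
  -- For the full `H¹` inner product, `A` represents the `L²` form and `1 - A` the Dirichlet form,
  -- so `hvolt` becomes an operator equation.
  set A : H10Space Ω →L[ℝ] H10Space Ω := (ContinuousLinearMap.adjoint ι).comp ι with hA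
  have hAι : ∀ p q, ⟪A p, q⟫ = ⟪ι p, ι q⟫ := fun p q =>
    ContinuousLinearMap.adjoint_inner_left ι q (ι p)
  have hAy := apply_eq_zero_of_volterra (A := A) (T := T) (y := y)
    (fun p q => by rw [hAι, real_inner_comm (A q), hAι, real_inner_comm]) hα0
    hyc fun t ht => by
      rw [eq_neg_iff_add_eq_zero]
      refine H10Space.eq_zero_of_inner_test fun φ hφ => ?_
      rw [sub_apply, one_apply_eq_self, inner_add_left, inner_sub_left,
        hAι, hAι, hvolt φ hφ t ht, H10Space.inner_eq]
      ring
  have hιy : ∀ t ∈ Icc 0 T, ι (y t) = 0 := fun t ht => by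
    rw [← inner_self_eq_zero (𝕜 := ℝ), ← hAι, hAy t ht, inner_zero_left]
  -- `ι (y t) = 0` says that the primitive of the continuous function `F φ` vanishes;
  -- differentiating recovers every interior time.
  have hF0 : ∀ φ, IsTestFunction Ω φ → ∀ t ∈ Ioo 0 T, F φ t = 0 := by
    intro φ hφ t ht
    have h1 := hasDerivAt_of_eq_integral (hadm φ hφ).1 (F := fun _ => 0)
      (fun s hs => by rw [← hval φ hφ s hs, hιy s hs, inner_zero_left]) ht
    exact h1.unique (hasDerivAt_const t 0)
  have hIoo : ∀ x ∈ Ω, ∀ t ∈ Ioo 0 T, u x t = u' x t := fun x hx t ht =>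
    eqOn_of_integral_test hΩ (continuousOn_slice_left huc (Ioo_subset_Icc_self ht))
      (continuousOn_slice_left huc' (Ioo_subset_Icc_self ht))
      (fun φ hφ => sub_eq_zero.1 (hF0 φ hφ t ht)) hx
  intro x hx t ht
  refine EqOn.of_subset_closure (s := Ioo 0 T) (t := Icc 0 T) (hIoo x hx)
    (continuousOn_slice_right huc hx) (continuousOn_slice_right huc' hx) Ioo_subset_Icc_self ?_ ht
  rw [closure_Ioo hT.ne]

end Solutions
end

noncomputable section

/-! ### The error recursion and its bounds. -/

section Iteration

variable {T : ℝ}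

theorem volterra_sub {f a b : ℝ → ℝ} {t : ℝ} (ht : 0 ≤ t)
    (ha : IntegrableOn (fun s => f (t - s) • a s) (Ioo 0 t))
    (hb : IntegrableOn (fun s => f (t - s) • b s) (Ioo 0 t)) :
    volterra f (fun s => a s - b s) t = volterra f a t - volterra f b t := by
  simp only [volterra_eq_setIntegral _ _ ht, smul_sub]
  exact integral_sub ha hb

theorem volterra_sub_of_continuousOn {f a b : ℝ → ℝ} (hf : ContinuousOn f (Icc 0 T))
    (ha : ContinuousOn a (Icc 0 T)) (hb : ContinuousOn b (Icc 0 T)) {t : ℝ} (ht : t ∈ Icc 0 T) :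
    volterra f (fun s => a s - b s) t = volterra f a t - volterra f b t :=
  volterra_sub ht.1 (integrableOn_volterra_integrand hf ha.integrableOn_Ioo_of_Icc ht)
    (integrableOn_volterra_integrand hf hb.integrableOn_Ioo_of_Icc ht)

theorem volterra_integral {f a : ℝ → ℝ} (hf : ContinuousOn f (Icc 0 T))
    (ha : ContinuousOn a (Icc 0 T)) {t : ℝ} (ht : t ∈ Icc 0 T) :
    volterra f (fun s => ∫ r in (0 : ℝ)..s, a r) t = ∫ s in (0 : ℝ)..t, volterra f a s := by
  have h1 : IntegrableOn (fun _ : ℝ => (1 : ℝ)) (Ioo 0 T) := continuousOn_const.integrableOn_Ioo_of_Icc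
  have hb : ∀ t ∈ Ioo 0 T, |(fun _ : ℝ => (1 : ℝ)) t| ≤ 1 := by simp
  have hf' := hf.integrableOn_Ioo_of_Icc
  have ha' := ha.integrableOn_Ioo_of_Icc
  rw [← volterra_one, ← volterra_assoc_of_bounded_left h1 hf' ha' hb ht,
    volterra_congr' ht.1 (fun r _ => volterra_comm _ f r) (fun _ _ => rfl),
    volterra_assoc_of_bounded_middle hf' h1 ha' hb ht]
  exact volterra_congr' ht.1 (fun _ _ => rfl) fun s _ => (volterra_one a s).symm

/-- The errors `w * ⋯ * w * r_{m+k}` (with `m` convolution factors `w`) of the iteration. -/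
def iterationError (w : ℝ → ℝ) (r : ℕ → ℝ → ℝ) : ℕ → ℕ → ℝ → ℝ
  | 0, k => r k
  | m + 1, k => volterra w (iterationError w r m (k + 1))

variable {w : ℝ → ℝ} {r : ℕ → ℝ → ℝ}

theorem continuousOn_iterationError (hT : 0 ≤ T) (hw : ContinuousOn w (Icc 0 T))
    (hr : ∀ k, ContinuousOn (r k) (Icc 0 T)) (m k : ℕ) :
    ContinuousOn (iterationError w r m k) (Icc 0 T) := by
  induction m generalizing k with
  | zero => exact hr k
  | succ m ih => exact continuousOn_volterra hT hw (ih (k + 1)).integrableOn_Ioo_of_Icc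

/-- Raising `k` differentiates the error: integration commutes with convolution by `w`. So every
error is again a flat source, to which Duhamel's formula applies. -/
theorem iterationError_eq_integral (hT : 0 ≤ T) (hw : ContinuousOn w (Icc 0 T))
    (hr : ∀ k, ContinuousOn (r k) (Icc 0 T))
    (hr' : ∀ k, ∀ t ∈ Icc 0 T, r k t = ∫ s in (0 : ℝ)..t, r (k + 1) s) (m k : ℕ) :
    ∀ t ∈ Icc 0 T, iterationError w r m k t =
      ∫ s in (0 : ℝ)..t, iterationError w r m (k + 1) s := by
  induction m generalizing k with
  | zero => exact hr' k
  | succ m ih =>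
    intro t ht
    have := volterra_integral hw (continuousOn_iterationError hT hw hr m (k + 2)) ht
    simp only [iterationError]
    rw [← this]
    exact volterra_congr' ht.1 (fun _ _ => rfl)
      fun s hs => ih (k + 1) s ⟨hs.1.le, hs.2.le.trans ht.2⟩

theorem isFlatSource_iterationError (hT : 0 ≤ T) (hw : ContinuousOn w (Icc 0 T))
    (hr : ∀ k, ContinuousOn (r k) (Icc 0 T))
    (hr' : ∀ k, ∀ t ∈ Icc 0 T, r k t = ∫ s in (0 : ℝ)..t, r (k + 1) s) (m : ℕ) :
    IsFlatSource T (iterationError w r m 0) (iterationError w r m 1) (iterationError w r m 2) :=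
  ⟨continuousOn_iterationError hT hw hr m 1, continuousOn_iterationError hT hw hr m 2,
    iterationError_eq_integral hT hw hr hr' m 0, iterationError_eq_integral hT hw hr hr' m 1⟩

/-- Replacing each `|w|` by `1` leaves an `m`-fold iterated integral of the constant `C`. -/
theorem abs_iterationError_le (hwb : ∀ t ∈ Icc 0 T, |w t| ≤ 1) {C : ℝ} (m k : ℕ)
    (hC : ∀ t ∈ Icc 0 T, |r (m + k) t| ≤ C) :
    ∀ t ∈ Icc 0 T, |iterationError w r m k t| ≤ C * (t ^ m / m.factorial) := by
  induction m generalizing k with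
  | zero => simpa [iterationError] using hC
  | succ m ih =>
    intro t ht
    have hb := ih (k + 1) (by rwa [show m + (k + 1) = m + 1 + k by ring])
    have hint : ∫ s in (0 : ℝ)..t, C * (s ^ m / m.factorial) =
        C * (t ^ (m + 1) / (m + 1).factorial) := by
      rw [intervalIntegral.integral_const_mul, intervalIntegral.integral_div, integral_pow,
        Nat.factorial_succ]
      push_cast
      field_simp
      simp
    rw [← hint, ← Real.norm_eq_abs]
    refine intervalIntegral.norm_integral_le_of_norm_le ht.1 ?_
      (Continuous.intervalIntegrable (by fun_prop) _ _)
    refine Eventually.of_forall fun s hs => ?_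
    have hs' : s ∈ Icc 0 T := ⟨hs.1.le, hs.2.trans ht.2⟩
    have hts : t - s ∈ Icc 0 T := ⟨by linarith [hs.2], by linarith [hs.1, ht.2]⟩
    rw [norm_smul, Real.norm_eq_abs, Real.norm_eq_abs]
    exact (mul_le_of_le_one_left (abs_nonneg _) (hwb _ hts)).trans (hb s hs')

theorem IsFlatSource.sub {ρ ρ₁ ρ₂ σ σ₁ σ₂ : ℝ → ℝ} (hρ : IsFlatSource T ρ ρ₁ ρ₂)
    (hσ : IsFlatSource T σ σ₁ σ₂) :
    IsFlatSource T (fun t => ρ t - σ t) (fun t => ρ₁ t - σ₁ t) (fun t => ρ₂ t - σ₂ t) where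
  continuousOn_one := hρ.continuousOn_one.sub hσ.continuousOn_one
  continuousOn_two := hρ.continuousOn_two.sub hσ.continuousOn_two
  eq_integral t ht := by
    rw [intervalIntegral.integral_sub
      (hρ.continuousOn_one.integrableOn_Ioo_of_Icc.intervalIntegrable_zero ht)
      (hσ.continuousOn_one.integrableOn_Ioo_of_Icc.intervalIntegrable_zero ht),
      hρ.eq_integral t ht, hσ.eq_integral t ht]
  one_eq_integral t ht := by
    rw [intervalIntegral.integral_sub
      (hρ.continuousOn_two.integrableOn_Ioo_of_Icc.intervalIntegrable_zero ht)
      (hσ.continuousOn_two.integrableOn_Ioo_of_Icc.intervalIntegrable_zero ht),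
      hρ.one_eq_integral t ht, hσ.one_eq_integral t ht]

theorem duhamel_sub {α : ℝ} (hT : 0 ≤ T) (hα : 0 < α) {a b V : ℝ → ℝ}
    (ha : ContinuousOn a (Icc 0 T)) (hb : ContinuousOn b (Icc 0 T))
    (hV : ContinuousOn V (Icc 0 T)) {t : ℝ} (ht : t ∈ Icc 0 T) :
    volterra (volterra (rlKernel α) (fun s => a s - b s)) V t =
      volterra (volterra (rlKernel α) a) V t - volterra (volterra (rlKernel α) b) V t := by
  have hk : ∀ {c : ℝ → ℝ}, ContinuousOn c (Icc 0 T) → ContinuousOn (volterra (rlKernel α) c)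
    (Icc 0 T) := fun hc => IsFlatSource.continuousOn_volterra_rlKernel hT hα hc
  rw [volterra_comm _ V, volterra_comm _ V, volterra_comm _ V,
    ← volterra_sub_of_continuousOn hV (hk ha) (hk hb) ht]
  refine volterra_congr' ht.1 (fun _ _ => rfl) fun s hs => ?_
  have hsT : s ≤ T := hs.2.le.trans ht.2
  exact volterra_sub hs.1.le (integrableOn_rlKernel_smul hα (ha.mono (Icc_subset_Icc_right hsT)))
    (integrableOn_rlKernel_smul hα (hb.mono (Icc_subset_Icc_right hsT)))

/-- For `f = e_m'` the right side is one step of the iteration, since `e_m(0) = 0`. -/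
theorem volterra_one_sub_div {V f : ℝ → ℝ} (K : ℝ) (hV : ContinuousOn V (Icc 0 T))
    (hf : ContinuousOn f (Icc 0 T)) {t : ℝ} (ht : t ∈ Icc 0 T) :
    volterra (fun s => 1 - V s / K) f t = (∫ s in (0 : ℝ)..t, f s) - volterra f V t / K := by
  rw [volterra_comm, volterra_sub_of_continuousOn hf continuousOn_const (hV.div_const K) ht,
    volterra_comm, volterra_one]
  congr 1
  rw [volterra, volterra, ← intervalIntegral.integral_div]
  simp only [smul_eq_mul, mul_div_assoc]

theorem iteratedDerivWithin_eq_integral {ρ : ℝ → ℝ} (hT : 0 < T)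
    (hρ : ContDiffOn ℝ ∞ ρ (Icc 0 T)) (hflat : ∀ m, iteratedDerivWithin m ρ (Icc 0 T) 0 = 0)
    (k : ℕ) : ∀ t ∈ Icc 0 T, iteratedDerivWithin k ρ (Icc 0 T) t =
      ∫ s in (0 : ℝ)..t, iteratedDerivWithin (k + 1) ρ (Icc 0 T) s := by
  intro t ht
  have hu := uniqueDiffOn_Icc hT
  have hd : DifferentiableOn ℝ (iteratedDerivWithin k ρ (Icc 0 T)) (Icc 0 T) :=
    hρ.differentiableOn_iteratedDerivWithin (by exact_mod_cast WithTop.coe_lt_top k) hu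
  have hc : ContinuousOn (iteratedDerivWithin (k + 1) ρ (Icc 0 T)) (Icc 0 T) :=
    hρ.continuousOn_iteratedDerivWithin (by exact_mod_cast le_top) hu
  rw [intervalIntegral.integral_eq_sub_of_hasDerivAt_of_le ht.1
    (hd.continuousOn.mono (Icc_subset_Icc_right ht.2)) (fun s hs => ?_)
    (hc.integrableOn_Ioo_of_Icc.intervalIntegrable_zero ht), hflat, sub_zero]
  have hs' : s ∈ Icc 0 T := ⟨hs.1.le, hs.2.le.trans ht.2⟩
  rw [iteratedDerivWithin_succ]
  exact (hd s hs').hasDerivWithinAt.hasDerivAt (Icc_mem_nhds hs.1 (hs.2.trans_le ht.2))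

end Iteration

end

/-! ### The main theorem. -/

theorem mainTheorem3 {d : ℕ} (hd : 1 ≤ d ∧ d ≤ 3)
    (Ω : Set (EuclideanSpace ℝ (Fin d))) (hΩo : IsOpen Ω) (hΩc : IsConnected Ω)
    (hΩb : Bornology.IsBounded Ω)
    (α T : ℝ) (hα0 : 0 < α) (hα1 : α < 1) (hT : 0 < T)
    (g : EuclideanSpace ℝ (Fin d) → ℝ) (x₀ : EuclideanSpace ℝ (Fin d)) (hx₀ : x₀ ∈ Ω)
    (v : EuclideanSpace ℝ (Fin d) → ℝ → ℝ) (hv : IsSolution α T Ω 0 0 g v)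
    (K : ℝ) (hK : 0 < K) (hvK : ∀ t ∈ Icc 0 T, 0 ≤ v x₀ t ∧ v x₀ t ≤ K)
    (L : ℕ) (hL : 0 < L)
    (ρstar : ℝ → ℝ) (hsmooth : ContDiffOn ℝ ∞ ρstar (Icc 0 T))
    (hflat : ∀ m : ℕ, iteratedDerivWithin m ρstar (Icc 0 T) 0 = 0) :
    (∃ ρ : ℕ → ℝ → ℝ, IsIteration α T K Ω g x₀ ρstar ρ) ∧
    ∀ ρ : ℕ → ℝ → ℝ, IsIteration α T K Ω g x₀ ρstar ρ →
      (∀ m : ℕ, ContinuousOn (ρ m) (Icc 0 T)) ∧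
      (∀ (M : ℝ) (m : ℕ),
        (∀ t ∈ Icc 0 T,
          |iteratedDerivWithin m ρstar (Icc 0 T) t| ≤ M * (8 * (L : ℝ) / T) ^ m) →
        ∀ t ∈ Icc 0 T, |ρ m t - ρstar t| ≤ M * (8 * (L : ℝ)) ^ m / (m.factorial : ℝ)) ∧
      (∀ M : ℝ,
        (∀ m : ℕ, ∀ t ∈ Icc 0 T,
          |iteratedDerivWithin m ρstar (Icc 0 T) t| ≤ M * (8 * (L : ℝ) / T) ^ m) →
        TendstoUniformlyOn ρ ρstar atTop (Icc 0 T)) := by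
  have hv' := hv
  obtain ⟨hvc, -, -⟩ := hv'
  set V : ℝ → ℝ := v x₀
  have hV : ContinuousOn V (Icc 0 T) := continuousOn_slice_right hvc hx₀
  set r : ℕ → ℝ → ℝ := fun k => iteratedDerivWithin k ρstar (Icc 0 T) with hrdef
  have hr : ∀ k, ContinuousOn (r k) (Icc 0 T) := fun k =>
    hsmooth.continuousOn_iteratedDerivWithin (by exact_mod_cast le_top) (uniqueDiffOn_Icc hT)
  have hr' : ∀ k, ∀ t ∈ Icc 0 T, r k t = ∫ s in (0 : ℝ)..t, r (k + 1) s :=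
    iteratedDerivWithin_eq_integral hT hsmooth hflat
  set w : ℝ → ℝ := fun s => 1 - V s / K with hw
  have hwc : ContinuousOn w (Icc 0 T) := continuousOn_const.sub (hV.div_const K)
  have hwb : ∀ t ∈ Icc 0 T, |w t| ≤ 1 := fun t ht => by
    have h1 : 0 ≤ V t / K := div_nonneg (hvK t ht).1 hK.le
    have h2 : V t / K ≤ 1 := (div_le_one hK).2 (hvK t ht).2
    rw [abs_le]
    constructor <;> simp only [hw] <;> linarith
  set e := iterationError w r with he
  have hec : ∀ m k, ContinuousOn (e m k) (Icc 0 T) := continuousOn_iterationError hT.le hwc hr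
  have hflatE : ∀ m, IsFlatSource T (e m 0) (e m 1) (e m 2) :=
    isFlatSource_iterationError hT.le hwc hr hr'
  have he0 : e 0 0 = ρstar := funext fun t => by
    simp [he, hrdef, iterationError]
  have hstar : IsFlatSource T ρstar (r 1) (r 2) := he0 ▸ hflatE 0
  have hflatm : ∀ m, IsFlatSource T (fun t => ρstar t - e m 0 t) (fun t => r 1 t - e m 1 t)
      (fun t => r 2 t - e m 2 t) := fun m => hstar.sub (hflatE m)
  have hsolstar := hv.duhamel hΩo hT.le hα0 hα1 hstar
  have hsol := fun m => hv.duhamel hΩo hT.le hα0 hα1 (hflatm m)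
  have hdiff : ∀ m, ∀ t ∈ Icc 0 T, volterra (volterra (rlKernel α) (e m 1)) V t =
      volterra (volterra (rlKernel α) (r 1)) V t -
        volterra (volterra (rlKernel α) (fun t => r 1 t - e m 1 t)) V t := by
    intro m t ht
    rw [duhamel_sub hT.le hα0 (hr 1) (hec m 1) hV ht]
    ring
  have hstep : ∀ m, ∀ t ∈ Icc 0 T,
      e (m + 1) 0 t = e m 0 t - volterra (e m 1) V t / K := by
    intro m t ht
    rw [(hflatE m).eq_integral t ht]
    exact volterra_one_sub_div K hV (hec m 1) ht
  have hcap : ∀ m, ∀ t ∈ Icc 0 T, caputo α (fun s =>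
      volterra (volterra (rlKernel α) (r 1)) V s -
        volterra (volterra (rlKernel α) (fun t => r 1 t - e m 1 t)) V s) t =
      volterra (e m 1) V t := by
    intro m t ht
    rw [← (hflatE m).caputo_volterra hα0 hα1 hV ht]
    exact caputo_congr (fun s hs => (hdiff m s (Ioo_subset_Icc_self hs)).symm) ht
  -- The iterates are written down in closed form, with Duhamel's formula supplying all solutions.
  refine ⟨⟨fun m t => ρstar t - e m 0 t, _, _, hsolstar, hsol, fun t _ => ?_, fun m => ?_,
    fun m t ht => ?_⟩, fun ρ hρ => ?_⟩
  · simp [he0]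
  · exact ((hflatE m).caputoAdmissible hT.le hα0 hV).congr (hdiff m)
  · have := hcap m t ht
    simp only [V] at this
    simp only [this]
    rw [hstep m t ht]
    ring
  -- An arbitrary run may use other solutions, and its sources are controlled only on `[0, T]`;
  -- uniqueness and `IsSolution.congr_source` identify its data at `x₀` with Duhamel's.
  have hρe : ∀ m, ∀ t ∈ Icc 0 T, ρ m t = ρstar t - e m 0 t := by
    obtain ⟨ustar, u, hus, hu, hρ0, -, hρs⟩ := hρ
    intro m
    induction m with
    | zero => intro t ht; rw [hρ0 t ht, he0, sub_self]
    | succ m ih =>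
      intro t ht
      have h1 := hus.unique hΩo hT hα0 hα1 hsolstar x₀ hx₀
      have h2 := ((hu m).congr_source fun s hs => ih s (Ioo_subset_Icc_self hs)).unique
        hΩo hT hα0 hα1 (hsol m) x₀ hx₀
      rw [hρs m t ht, ih t ht, hstep m t ht, ← hcap m t ht,
        caputo_congr (fun s hs => by
          rw [h1 s (Ioo_subset_Icc_self hs), h2 s (Ioo_subset_Icc_self hs)]) ht]
      ring
  have hbound : ∀ (M : ℝ) (m : ℕ), (∀ t ∈ Icc 0 T,
      |iteratedDerivWithin m ρstar (Icc 0 T) t| ≤ M * (8 * (L : ℝ) / T) ^ m) →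
      ∀ t ∈ Icc 0 T, |ρ m t - ρstar t| ≤ M * (8 * (L : ℝ)) ^ m / (m.factorial : ℝ) := by
    intro M m hM t ht
    have hC0 : 0 ≤ M * (8 * (L : ℝ) / T) ^ m := (abs_nonneg _).trans (hM t ht)
    have h1 := abs_iterationError_le (r := r) hwb m 0 hM t ht
    have h2 : t ^ m / (m.factorial : ℝ) ≤ T ^ m / m.factorial := by
      gcongr
      exacts [ht.1, ht.2]
    rw [hρe m t ht, show ρstar t - e m 0 t - ρstar t = -e m 0 t by ring, abs_neg]
    refine h1.trans ((mul_le_mul_of_nonneg_left h2 hC0).trans (le_of_eq ?_))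
    rw [div_pow]
    field_simp
  refine ⟨fun m => ?_, hbound, fun M hM => ?_⟩
  · exact (hsmooth.continuousOn.sub (hec m 0)).congr (hρe m)
  · rw [Metric.tendstoUniformlyOn_iff]
    intro ε hε
    have hlim : Tendsto (fun m : ℕ => M * ((8 * (L : ℝ)) ^ m / (m.factorial : ℝ))) atTop (𝓝 0) := by
      simpa using (FloorSemiring.tendsto_pow_div_factorial_atTop (8 * (L : ℝ))).const_mul M
    filter_upwards [hlim.eventually (gt_mem_nhds hε)] with m hm t ht
    rw [dist_comm, Real.dist_eq]
    refine (hbound M m (hM m) t ht).trans_lt ?_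
    rwa [mul_div_assoc]
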